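/- Let $p$ be a prime, let $K$ be a field of characteristic $p$, and let $G$ be a finite cyclic group of order $q=p^{\alpha}$. Let $V_1,\dots,V_q$ represent the isomorphism classes of indecomposable $KG$-modules, with $\dim V_i=i$, and let $V_0=0$. For $0\le m\le n\le q$, the Jordan partition $\lambda(m,n,p)=(\lambda_1,\dots,\lambda_m)$ is given by $V_m\otimes V_n\cong V_{\lambda_1}\oplus\dots\oplus V_{\lambda_m}$ with $\lambda_1\ge\dots\ge\lambda_m>0$ (it is the empty partition for $m=0$). It is called standard if $\lambda_i=m+n-2i+1$ for $1\le i\le m$; in particular the empty partition is standard. Let $m,n$ be integers with $0<m\le n\le q$, let $k\ge 0$ be the integer with $p^k\le n<p^{k+1}$, and write $n=bp^k+d$ and $m=ap^k+c$ with $0<b<p$, $0\le a<p$, $0\le c,d<p^k$. Then: 1. If $m+n>p^{k+1}$, then $\lambda(m,n,p)$ is standard if and only if $m+n-p^{k+1}=1$ and $\lambda(p^{k+1}-n,\,p^{k+1}-m,\,p)$ is standard. 2. If $m+n\le p^{k+1}$ and $c+d>p^k$, then $\lambda(m,n,p)$ is standard if and only if $c+d-p^k=1$ and $\lambda((a+b+1)p^k-n,\,(a+b+1)p^k-m,\,p)$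 is standard. 3. If $m+n\le p^{k+1}$, $1\le c+d\le p^k$ and $a>0$, then $\lambda(m,n,p)$ is standard if and only if $\lambda(\min(c,d),\max(c,d),p)$ is standard, $|c-d|\le 1$, and $\lambda((a+b)p^k-n,\,(a+b)p^k-m,\,p)$ is standard. 4. If $m+n\le p^{k+1}$, $1\le c+d\le p^k$, $a=0$ and $d>0$, then $\lambda(m,n,p)$ is standard if and only if $\lambda(m,\,bp^k-d,\,p)$ is standard. 5. If $m+n\le p^{k+1}$, $1\le c+d\le p^k$, $a=0$ and $d=0$, then $\lambda(m,n,p)$ is standard if and only if $m=1$. 6. If $m+n\le p^{k+1}$ and $c=d=0$, then $\lambda(m,n,p)$ is standard if and only if $k=0$. -/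

import Mathlib

/-- A `KG`-module (a representation of `G` over `K`) is indecomposable if it is nonzero and is not
the direct sum of two nonzero submodules. -/
def IsIndecomposableRep {K G W : Type*} [Field K] [Group G] [AddCommGroup W] [Module K W]
    (σ : Representation K G W) : Prop :=
  Nontrivial W ∧ ∀ A B : Subrepresentation σ,
    IsCompl A.toSubmodule B.toSubmodule → A.toSubmodule = ⊥ ∨ B.toSubmodule = ⊥

/-- `V 1, …, V q` are indecomposable `KG`-modules with `dim (V i) = i`, and `V 0` is the zero
module. If `G` is cyclic of order `q`, a power of the characteristic of `K`, then there is exactly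
one indecomposable `KG`-module of each dimension `1, …, q` up to isomorphism and there are no
others, so `V 1, …, V q` represent all the isomorphism classes. -/
structure IsIndecomposableSystem {K G : Type*} [Field K] [Group G] {V : ℕ → Type*}
    [∀ i, AddCommGroup (V i)] [∀ i, Module K (V i)]
    (ρ : ∀ i, Representation K G (V i)) (q : ℕ) : Prop where
  finiteDimensional : ∀ i ≤ q, FiniteDimensional K (V i)
  finrank_eq : ∀ i ≤ q, Module.finrank K (V i) = i
  indecomposable : ∀ i, 1 ≤ i → i ≤ q → IsIndecomposableRep (ρ i)

/-- `l = (l 0, …, l (m - 1))` is the Jordan partition of `m * n`: it is nonincreasing with positive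
parts, and `V m ⊗ V n` (with the diagonal action) is isomorphic to the direct sum of the
indecomposable modules `V (l 0), …, V (l (m - 1))`. By the Krull–Schmidt theorem there is at most
one such `l`. For `m = 0` it is the empty partition. -/
def IsJordanPartition {K G : Type*} [Field K] [Group G] {V : ℕ → Type*}
    [∀ i, AddCommGroup (V i)] [∀ i, Module K (V i)]
    (ρ : ∀ i, Representation K G (V i)) (q m n : ℕ) (l : Fin m → ℕ) : Prop :=
  Antitone l ∧ (∀ i, 1 ≤ l i ∧ l i ≤ q) ∧
    Nonempty (((ρ m).tprod (ρ n)).Equiv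
      (Representation.directSum (fun i : Fin m => ρ (l i))))

/-- The Jordan partition `(l 0, …, l (m - 1))` of `m * n` is standard: its `i`-th part, counted
from `1`, is `m + n - 2 * i + 1`. -/
def IsStandardJordanPartition {K G : Type*} [Field K] [Group G] {V : ℕ → Type*}
    [∀ i, AddCommGroup (V i)] [∀ i, Module K (V i)]
    (ρ : ∀ i, Representation K G (V i)) (q m n : ℕ) : Prop :=
  ∃ l : Fin m → ℕ, IsJordanPartition ρ q m n l ∧
    ∀ i : Fin m, (l i : ℤ) = (m : ℤ) + n - 2 * ((i : ℤ) + 1) + 1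

/-! Let `g` generate `G`. Each `V i` with `i ≤ q` is one Jordan block for the nilpotent operator `g
- 1`. In a suitable basis of `V m ⊗ V n`, `g - 1` acts as multiplication by `x + y` on `K[x, y] / (x
^ m, y ^ n)`. The kernel of `x + y` contains an alternating sum of monomials in each degree `m + n -
c - 1`, `1 ≤ c ≤ m`. The partition is standard exactly when each such vector is `(x + y) ^ (m + n -
2c)` applied to a form of degree `c - 1`. The obstruction is the `c × c` determinant of binomial
coefficients `chooseToeplitz (m - c) (n - c) c`: if it is nonzero in `K` the strings can be built
(`exists_strings`), and if it is zero the rank of the power is too small (`det_ne_zero_of_strings`).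

Over `ℤ` this determinant is MacMahon's number of plane partitions in a box, a quotient of
factorials. By Legendre's formula its `p`-adic valuation is a sum over `s` of nonnegative terms
depending only on residues mod `p ^ s` (`boxExcess_mod`). Asking that all terms vanish for all `c`
gives inequalities on the residues of `m` and `n` (`forall_boxGood_iff`), hence the criterion
`StdNum`. The six cases are then arithmetic: the inequalities survive reflections of `m` and `n`,
and the moduli `p ^ k` and `p ^ (k + 1)` supply the extra conditions. -/

/-! ### Determinants of binomial Toeplitz matrices: MacMahon's box formula. -/

/-- The Toeplitz matrix of binomial coefficients `(a + b).choose (a + s - i)`, with zero entries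
where `a + s < i`. -/
def chooseToeplitz (a b c : ℕ) : Matrix (Fin c) (Fin c) ℤ :=
  Matrix.of fun i s => if (i : ℕ) ≤ a + s then ((a + b).choose (a + s - i) : ℤ) else 0

theorem det_pascal_eq_one (c : ℕ) :
    (Matrix.of fun i l : Fin c => ((i : ℕ).choose l : ℤ)).det = 1 := by
  rw [Matrix.det_of_isLowerTriangular]
  · simp
  · intro i j hij
    have : (i : ℕ) < j := hij
    simp [Nat.choose_eq_zero_of_lt this]

/-- Vandermonde's convolution. Multiplying by the unimodular Pascal matrix leaves the determinant
unchanged and makes the entries single binomials without the cut-off. -/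
theorem pascal_mul_chooseToeplitz (a b c : ℕ) :
    (Matrix.of fun i l : Fin c => ((i : ℕ).choose l : ℤ)) * chooseToeplitz a b c =
      Matrix.of fun i s : Fin c => ((a + b + i).choose (a + s) : ℤ) := by
  ext i s
  rw [Matrix.mul_apply, Matrix.of_apply, add_comm (a + b) (i : ℕ), Nat.add_choose_eq,
    Finset.Nat.sum_antidiagonal_eq_sum_range_succ_mk]
  simp only [chooseToeplitz, Matrix.of_apply]
  rw [Fin.sum_univ_eq_sum_range (fun l => ((i : ℕ).choose l : ℤ) *
    if l ≤ a + s then ((a + b).choose (a + s - l) : ℤ) else 0) c]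
  push_cast
  have key : ∀ u v : ℕ, (∀ l, l < u → v ≤ l →
      ((i : ℕ).choose l : ℤ) * (if l ≤ a + s then ((a + b).choose (a + s - l) : ℤ) else 0) = 0) →
      ∑ l ∈ Finset.range u, ((i : ℕ).choose l : ℤ) *
        (if l ≤ a + s then ((a + b).choose (a + s - l) : ℤ) else 0) =
      ∑ l ∈ Finset.range (min u v), ((i : ℕ).choose l : ℤ) *
        (if l ≤ a + s then ((a + b).choose (a + s - l) : ℤ) else 0) := by
    intro u v h
    symm
    apply Finset.sum_subset
    · intro l; simp only [Finset.mem_range]; omega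
    · intro l h1 h2
      simp only [Finset.mem_range] at h1 h2
      exact h l h1 (by omega)
  rw [key c (a + s + 1), min_comm, ← key (a + s + 1) c]
  · apply Finset.sum_congr rfl
    intro l hl
    rw [if_pos (by simp only [Finset.mem_range] at hl; omega)]
  · intro l _ h
    rw [Nat.choose_eq_zero_of_lt (by omega)]
    simp
  · intro l _ h
    rw [if_neg (by omega), mul_zero]

/-- Falling factorials are monic of degree `s`, so this is a Vandermonde determinant at the points
`b + i`, and translation by `b` does not matter. -/
theorem det_descFactorial (b c : ℕ) :
    (Matrix.of fun i s : Fin c => ((b + i : ℕ).descFactorial s : ℤ)).det =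
      ∏ i ∈ Finset.range c, (i.factorial : ℤ) := by
  have h := Matrix.det_eval_matrixOfPolynomials_eq_det_vandermonde
    (fun i : Fin c => ((b + i : ℕ) : ℤ)) (fun s => descPochhammer ℤ s)
    (fun s => descPochhammer_natDegree ℤ s) (fun s => monic_descPochhammer ℤ s)
  simp only [descPochhammer_eval_eq_descFactorial] at h
  rw [← h]
  have h2 := Matrix.det_vandermonde_add (fun i : Fin c => ((i : ℕ) : ℤ)) (b : ℤ)
  simp only [Nat.cast_add, add_comm (b : ℤ)]
  rw [h2]
  cases c with
  | zero => simp
  | succ n =>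
    rw [Matrix.det_vandermonde_id_eq_superFactorial, ← Nat.prod_range_succ_factorial]
    push_cast
    rfl

theorem choose_mul_factorial_mul_factorial_eq (a b i s : ℕ) :
    (b + i).factorial * (a + b + i).choose (a + s) * (a + s).factorial =
      (a + b + i).factorial * (b + i).descFactorial s := by
  rw [mul_assoc, mul_comm (Nat.choose _ _), ← Nat.descFactorial_eq_factorial_mul_choose]
  rcases le_or_gt s (b + i) with h | h
  · have h1 := Nat.factorial_mul_descFactorial (n := a + b + i) (k := a + s) (by omega)
    have h2 := Nat.factorial_mul_descFactorial h
    rw [show a + b + i - (a + s) = b + i - s by omega] at h1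
    rw [← h1, ← h2]
    ring
  · rw [Nat.descFactorial_eq_zero_iff_lt.2 h, Nat.descFactorial_eq_zero_iff_lt.2 (by omega),
      mul_zero, mul_zero]

/-- MacMahon's formula with denominators cleared: scaling rows and columns by factorials turns the
binomial matrix into the falling factorial one. -/
theorem det_chooseToeplitz_mul (a b c : ℕ) :
    (chooseToeplitz a b c).det *
      ((∏ s ∈ Finset.range c, ((a + s).factorial : ℤ)) *
        ∏ i ∈ Finset.range c, ((b + i).factorial : ℤ)) =
      (∏ i ∈ Finset.range c, ((a + b + i).factorial : ℤ)) *
        ∏ i ∈ Finset.range c, (i.factorial : ℤ) := by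
  have h1 := congrArg Matrix.det (pascal_mul_chooseToeplitz a b c)
  rw [Matrix.det_mul, det_pascal_eq_one, one_mul] at h1
  have h2 := Matrix.det_mul_row (fun s : Fin c => ((a + s : ℕ).factorial : ℤ))
    (Matrix.of fun i s : Fin c => ((a + b + i).choose (a + s) : ℤ))
  have h3 := Matrix.det_mul_column (fun i : Fin c => ((b + i : ℕ).factorial : ℤ))
    (Matrix.of fun i j : Fin c => ((a + j : ℕ).factorial : ℤ) *
      (Matrix.of fun i s : Fin c => ((a + b + i).choose (a + s) : ℤ)) i j)
  have h4 := Matrix.det_mul_column (fun i : Fin c => ((a + b + i : ℕ).factorial : ℤ))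
    (Matrix.of fun i s : Fin c => ((b + i : ℕ).descFactorial s : ℤ))
  rw [det_descFactorial] at h4
  rw [h2, ← h1] at h3
  simp only [← Fin.prod_univ_eq_prod_range] at h4 ⊢
  rw [← h4, mul_left_comm, mul_comm (chooseToeplitz a b c).det, mul_left_comm, ← h3]
  congr 1
  ext i s
  have := choose_mul_factorial_mul_factorial_eq a b i s
  simp only [Matrix.of_apply]
  rw [mul_comm ((a + s).factorial : ℤ), ← mul_assoc]
  exact_mod_cast this

/-! ### The `p`-adic valuation of the box number. -/

/-- The excess of `⌊i / N⌋`-sums in the MacMahon box formula. -/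
def boxExcess (N a b c : ℕ) : ℤ :=
  ∑ i ∈ Finset.range c, (((a + b + i) / N : ℕ) + (i / N : ℕ) - ((a + i) / N : ℕ) -
    ((b + i) / N : ℕ) : ℤ)

theorem padicValNat_prod_factorial (p : ℕ) [Fact p.Prime] (a c B : ℕ) (hB : a + c < p ^ B) :
    padicValNat p (∏ i ∈ Finset.range c, (a + i).factorial) =
      ∑ s ∈ Finset.Ico 1 B, ∑ i ∈ Finset.range c, (a + i) / p ^ s := by
  rw [Finset.sum_comm]
  induction c with
  | zero => simp
  | succ c ih =>
    rw [Finset.prod_range_succ, Finset.sum_range_succ, padicValNat.mul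
      (Finset.prod_ne_zero_iff.2 fun i _ => Nat.factorial_ne_zero _) (Nat.factorial_ne_zero _),
      ih (by omega), padicValNat_factorial (b := B)
        (Nat.log_lt_of_lt_pow' (by rintro rfl; simp at hB) (by omega))]

/-- Legendre's formula applied to every factorial in `det_chooseToeplitz_mul`. -/
theorem sum_boxExcess_eq_padicValNat (p : ℕ) [Fact p.Prime] (a b c B : ℕ)
    (hB : a + b + c < p ^ B) :
    (padicValNat p (chooseToeplitz a b c).det.natAbs : ℤ) =
      ∑ s ∈ Finset.Ico 1 B, boxExcess (p ^ s) a b c := by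
  have h := congrArg Int.natAbs (det_chooseToeplitz_mul a b c)
  have hne : ∀ t : ℕ, ∏ i ∈ Finset.range c, (t + i).factorial ≠ 0 := fun t =>
    Finset.prod_ne_zero_iff.2 fun i _ => Nat.factorial_ne_zero _
  have hne0 : ∏ i ∈ Finset.range c, i.factorial ≠ 0 := by simpa using hne 0
  simp only [← Nat.cast_prod, Int.natAbs_mul, Int.natAbs_natCast] at h
  have hd : (chooseToeplitz a b c).det.natAbs ≠ 0 := by
    intro h0
    rw [h0, zero_mul] at h
    exact mul_ne_zero (hne (a + b)) hne0 h.symm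
  have h' := congrArg (padicValNat p) h
  rw [padicValNat.mul hd (mul_ne_zero (hne a) (hne b)), padicValNat.mul (hne a) (hne b),
    padicValNat.mul (hne (a + b)) hne0, padicValNat_prod_factorial p a c B (by omega),
    padicValNat_prod_factorial p b c B (by omega),
    padicValNat_prod_factorial p (a + b) c B (by omega)] at h'
  have h0 := padicValNat_prod_factorial p 0 c B (by omega)
  simp only [zero_add] at h0
  rw [h0] at h'
  have h'' := congrArg (Nat.cast : ℕ → ℤ) h'
  push_cast at h''
  simp only [boxExcess, Finset.sum_add_distrib, Finset.sum_sub_distrib]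
  push_cast
  linarith

/-- The boundary value `v = N` is admitted because the induction on `u` passes through it. -/
theorem two_mul_sum_range_div (N u v : ℕ) (hN : 0 < N) (hv : v ≤ N) :
    2 * ∑ i ∈ Finset.range (N * u + v), ((i / N : ℕ) : ℤ) = N * u * (u - 1) + 2 * u * v := by
  induction u generalizing v with
  | zero =>
    rw [Finset.sum_eq_zero]
    · simp
    · intro i hi
      simp only [Finset.mem_range] at hi
      simp [Nat.div_eq_of_lt (show i < N by omega)]
  | succ u ih =>
    induction v with
    | zero =>
      have := ih N le_rfl
      rw [mul_add, mul_one, add_zero, this]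
      push_cast; ring
    | succ v ihv =>
      rw [← add_assoc, Finset.sum_range_succ, mul_add, ihv (by omega),
        Nat.mul_add_div hN, Nat.div_eq_of_lt (by omega)]
      push_cast; ring

theorem boxExcess_eq (N a b c : ℕ) :
    boxExcess N a b c = ∑ i ∈ Finset.range (a + b + c), ((i / N : ℕ) : ℤ)
      + ∑ i ∈ Finset.range a, ((i / N : ℕ) : ℤ) + ∑ i ∈ Finset.range b, ((i / N : ℕ) : ℤ)
      + ∑ i ∈ Finset.range c, ((i / N : ℕ) : ℤ) - ∑ i ∈ Finset.range (a + b), ((i / N : ℕ) : ℤ)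
      - ∑ i ∈ Finset.range (a + c), ((i / N : ℕ) : ℤ)
      - ∑ i ∈ Finset.range (b + c), ((i / N : ℕ) : ℤ) := by
  simp only [boxExcess, Finset.sum_range_add, Finset.sum_add_distrib, Finset.sum_sub_distrib]
  ring

/-- The sum `∑ i < n, ⌊i / N⌋` doubled, for `n = N * u + v` with `v ≤ 3 * N`. -/
theorem two_mul_sum_range_div' (N u v : ℕ) (hN : 0 < N) (hv : v ≤ 3 * N) :
    2 * ∑ i ∈ Finset.range (N * u + v), ((i / N : ℕ) : ℤ) = N * u * (u - 1) + 2 * u * v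
      + 2 * max 0 ((v : ℤ) - N) + 2 * max 0 ((v : ℤ) - 2 * N) := by
  rcases le_or_gt v N with h | h
  · rw [two_mul_sum_range_div N u v hN h, max_eq_left (by omega), max_eq_left (by omega)]
    ring
  rcases le_or_gt v (2 * N) with h' | h'
  · obtain ⟨w, rfl⟩ := Nat.exists_eq_add_of_lt h
    rw [show N * u + (N + w + 1) = N * (u + 1) + (w + 1) by ring,
      two_mul_sum_range_div N (u + 1) (w + 1) hN (by omega), max_eq_right (by omega),
      max_eq_left (by omega)]
    push_cast; ring
  · obtain ⟨w, rfl⟩ := Nat.exists_eq_add_of_lt h'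
    rw [show N * u + (2 * N + w + 1) = N * (u + 2) + (w + 1) by ring,
      two_mul_sum_range_div N (u + 2) (w + 1) hN (by omega), max_eq_right (by omega),
      max_eq_right (by omega)]
    push_cast; ring

/-- In the alternating sum of `boxExcess_eq` the contributions of the quotients cancel; only the
carries among the residues remain. -/
theorem boxExcess_mod (N a b c : ℕ) (hN : 0 < N) :
    boxExcess N a b c = max 0 (((a % N + b % N + c % N : ℕ) : ℤ) - N)
      + max 0 (((a % N + b % N + c % N : ℕ) : ℤ) - 2 * N)
      - max 0 (((a % N + b % N : ℕ) : ℤ) - N) - max 0 (((a % N + c % N : ℕ) : ℤ) - N)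
      - max 0 (((b % N + c % N : ℕ) : ℤ) - N) := by
  have ha := Nat.mod_lt a hN
  have hb := Nat.mod_lt b hN
  have hc := Nat.mod_lt c hN
  have ea := Nat.div_add_mod a N
  have eb := Nat.div_add_mod b N
  have ec := Nat.div_add_mod c N
  rw [boxExcess_eq]
  generalize a % N = x at *
  generalize b % N = y at *
  generalize c % N = z at *
  generalize a / N = u at *
  generalize b / N = v at *
  generalize c / N = w at *
  subst ea eb ec
  have e1 := two_mul_sum_range_div' N (u + v + w) (x + y + z) hN (by omega)
  have e2 := two_mul_sum_range_div' N u x hN (by omega)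
  have e3 := two_mul_sum_range_div' N v y hN (by omega)
  have e4 := two_mul_sum_range_div' N w z hN (by omega)
  have e5 := two_mul_sum_range_div' N (u + v) (x + y) hN (by omega)
  have e6 := two_mul_sum_range_div' N (u + w) (x + z) hN (by omega)
  have e7 := two_mul_sum_range_div' N (v + w) (y + z) hN (by omega)
  rw [max_eq_left (a := (0 : ℤ)) (b := _ - 2 * _) (by omega)] at e2 e3 e4 e5 e6 e7
  rw [max_eq_left (a := (0 : ℤ)) (b := _ - _) (by omega)] at e2 e3 e4
  rw [show N * u + x + (N * v + y) + (N * w + z) = N * (u + v + w) + (x + y + z) by ring,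
    show N * u + x + (N * v + y) = N * (u + v) + (x + y) by ring,
    show N * u + x + (N * w + z) = N * (u + w) + (x + z) by ring,
    show N * v + y + (N * w + z) = N * (v + w) + (y + z) by ring]
  push_cast at *
  linarith

/-- The condition on residues under which `boxExcess` vanishes. -/
def BoxGood (N a b c : ℕ) : Prop :=
  a % N = 0 ∨ b % N = 0 ∨ c % N = 0 ∨ a % N + b % N + c % N ≤ N ∨
    2 * N ≤ a % N + b % N + c % N

theorem boxExcess_nonneg (N a b c : ℕ) (hN : 0 < N) : 0 ≤ boxExcess N a b c := by
  have ha := Nat.mod_lt a hN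
  have hb := Nat.mod_lt b hN
  have hc := Nat.mod_lt c hN
  rw [boxExcess_mod N a b c hN]
  omega

theorem boxExcess_eq_zero_iff (N a b c : ℕ) (hN : 0 < N) :
    boxExcess N a b c = 0 ↔ BoxGood N a b c := by
  have ha := Nat.mod_lt a hN
  have hb := Nat.mod_lt b hN
  have hc := Nat.mod_lt c hN
  rw [boxExcess_mod N a b c hN, BoxGood]
  omega

theorem det_chooseToeplitz_ne_zero (a b c : ℕ) : (chooseToeplitz a b c).det ≠ 0 := by
  intro h
  have h1 := det_chooseToeplitz_mul a b c
  rw [h, zero_mul] at h1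
  refine mul_ne_zero ?_ ?_ h1.symm <;>
  exact Finset.prod_ne_zero_iff.2 fun i _ => Nat.cast_ne_zero.2 (Nat.factorial_ne_zero _)

theorem not_dvd_det_chooseToeplitz_iff (p : ℕ) [hp : Fact p.Prime] (a b c : ℕ) :
    ¬ (p : ℤ) ∣ (chooseToeplitz a b c).det ↔ ∀ s, 1 ≤ s → BoxGood (p ^ s) a b c := by
  have hpos : ∀ s, 0 < p ^ s := fun s => pow_pos hp.out.pos s
  have h0 : ¬ (p : ℤ) ∣ (chooseToeplitz a b c).det ↔
      (padicValNat p (chooseToeplitz a b c).det.natAbs : ℤ) = 0 := by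
    rw [Int.natCast_dvd, Nat.cast_eq_zero, padicValNat.eq_zero_iff]
    have := det_chooseToeplitz_ne_zero a b c
    have := hp.out.ne_one
    have h3 : (chooseToeplitz a b c).det.natAbs ≠ 0 := by simpa
    tauto
  -- The slack `t` lets any prescribed `s` fall inside the range of Legendre's sum.
  have hB : ∀ t, a + b + c < p ^ (a + b + c + t) := fun t =>
    lt_of_lt_of_le (Nat.lt_pow_self hp.out.one_lt) (Nat.pow_le_pow_right hp.out.pos (by omega))
  constructor
  · intro h s hs
    have h1 := h0.1 h
    rw [sum_boxExcess_eq_padicValNat p a b c _ (hB (s + 1)), Finset.sum_eq_zero_iff_of_nonneg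
      (fun i _ => boxExcess_nonneg _ _ _ _ (hpos i))] at h1
    exact (boxExcess_eq_zero_iff _ _ _ _ (hpos s)).1
      (h1 s (Finset.mem_Ico.2 ⟨hs, by omega⟩))
  · intro h
    rw [h0, sum_boxExcess_eq_padicValNat p a b c _ (hB 0)]
    exact Finset.sum_eq_zero fun s hs =>
      (boxExcess_eq_zero_iff _ _ _ _ (hpos s)).2 (h s (Finset.mem_Ico.1 hs).1)

/-! ### The residue criterion at one modulus. -/

/-- The condition at `N = p ^ s` for the standardness of the Jordan partition of `m * n`. -/
def StdAt (N m n : ℕ) : Prop :=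
  (N ≤ m → m % N ≤ n % N + 1 ∧ n % N ≤ m % N + 1 ∧ m % N + n % N ≤ N + 1 ∧
    N ≤ m % N + n % N + 1) ∧
  (m < N → m ≤ n % N + 1 ∧ m + n % N ≤ N + 1)

theorem sub_mod_cases (N m c : ℕ) (hN : 0 < N) (hc : c ≤ m) :
    (c % N ≤ m % N ∧ (m - c) % N = m % N - c % N) ∨
      (m % N < c % N ∧ (m - c) % N = N + m % N - c % N) := by
  have h1 := Nat.mod_lt m hN
  have h2 := Nat.mod_lt c hN
  have h3 := Nat.mod_lt (m - c) hN
  have h : ((m - c) + c) % N = m % N := by rw [Nat.sub_add_cancel hc]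
  rw [Nat.add_mod] at h
  generalize (m - c) % N = x at *
  generalize c % N = y at *
  generalize m % N = z at *
  rcases lt_or_ge (x + y) N with h4 | h4
  · rw [Nat.mod_eq_of_lt h4] at h; omega
  · rw [Nat.mod_eq_sub_mod h4, Nat.mod_eq_of_lt (by omega)] at h; omega

/-- Passing from `m` and `n` to `m - c` and `n - c` shifts both residues down by that of `c`, with a
possible wrap-around. The inequalities of `StdAt` come from the extreme admissible values of `c`. -/
theorem forall_boxGood_iff (N m n : ℕ) (hN : 2 ≤ N) (hmn : m ≤ n) :
    (∀ c, 1 ≤ c → c ≤ m → BoxGood N (m - c) (n - c) c) ↔ StdAt N m n := by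
  have hN0 : 0 < N := by omega
  have hM := Nat.mod_lt m hN0
  have hD := Nat.mod_lt n hN0
  constructor
  · intro h
    have H : ∀ z, 1 ≤ z → z < N → z ≤ m → BoxGood N (m - z) (n - z) z ∧
        ((z ≤ m % N ∧ (m - z) % N = m % N - z) ∨ (m % N < z ∧ (m - z) % N = N + m % N - z)) ∧
        ((z ≤ n % N ∧ (n - z) % N = n % N - z) ∨ (n % N < z ∧ (n - z) % N = N + n % N - z)) := by
      intro z h1 h2 h3
      have e1 := sub_mod_cases N m z hN0 h3
      have e2 := sub_mod_cases N n z hN0 (h3.trans hmn)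
      rw [Nat.mod_eq_of_lt h2] at e1 e2
      exact ⟨h z h1 h3, e1, e2⟩
    clear h
    have H1 : ∀ z, 1 ≤ z → z < N → z ≤ m → z < m % N → z < n % N → m % N + n % N ≤ N + z := by
      intro z h1 h2 h3 h4 h5
      obtain ⟨hb, e1, e2⟩ := H z h1 h2 h3
      rw [BoxGood, Nat.mod_eq_of_lt h2] at hb
      omega
    -- `H1` to `H4` are the four positions of `z` relative to the two residues. The number of
    -- wrap-arounds decides which of the bounds `≤ N` and `≥ 2 * N` in `BoxGood` can hold.
    have H2 : ∀ z, 1 ≤ z → z < N → z ≤ m → z < m % N → n % N < z → N + z ≤ m % N + n % N := by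
      intro z h1 h2 h3 h4 h5
      obtain ⟨hb, e1, e2⟩ := H z h1 h2 h3
      rw [BoxGood, Nat.mod_eq_of_lt h2] at hb
      omega
    have H3 : ∀ z, 1 ≤ z → z < N → z ≤ m → m % N < z → z < n % N → N + z ≤ m % N + n % N := by
      intro z h1 h2 h3 h4 h5
      obtain ⟨hb, e1, e2⟩ := H z h1 h2 h3
      rw [BoxGood, Nat.mod_eq_of_lt h2] at hb
      omega
    have H4 : ∀ z, 1 ≤ z → z < N → z ≤ m → m % N < z → n % N < z → z ≤ m % N + n % N := by
      intro z h1 h2 h3 h4 h5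
      obtain ⟨hb, e1, e2⟩ := H z h1 h2 h3
      rw [BoxGood, Nat.mod_eq_of_lt h2] at hb
      omega
    clear H
    refine ⟨fun hm => ⟨?_, ?_, ?_, ?_⟩, fun hm => ⟨?_, ?_⟩⟩
    · by_contra hc
      have := H2 (n % N + 1) (by omega) (by omega) (by omega) (by omega) (by omega)
      omega
    · by_contra hc
      have := H3 (m % N + 1) (by omega) (by omega) (by omega) (by omega) (by omega)
      omega
    · by_contra hc
      have := H1 1 (by omega) (by omega) (by omega) (by omega) (by omega)
      omega
    · by_contra hc
      have := H4 (N - 1) (by omega) (by omega) (by omega) (by omega) (by omega)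
      omega
    · rw [Nat.mod_eq_of_lt hm] at *
      by_contra hc
      have := H2 (n % N + 1) (by omega) (by omega) (by omega) (by omega) (by omega)
      omega
    · rw [Nat.mod_eq_of_lt hm] at *
      by_contra hc
      have := H1 1 (by omega) (by omega) (by omega) (by omega) (by omega)
      omega
  · intro h c hc1 hcm
    have hC := Nat.mod_lt c hN0
    have e1 := sub_mod_cases N m c hN0 hcm
    have e2 := sub_mod_cases N n c hN0 (hcm.trans hmn)
    rw [BoxGood]
    rw [StdAt] at h
    rcases le_or_gt N m with hm | hm
    · obtain ⟨h1, h2, h3, h4⟩ := h.1 hm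
      clear h
      rcases e1 with ⟨e1, e1'⟩ | ⟨e1, e1'⟩ <;> rcases e2 with ⟨e2, e2'⟩ | ⟨e2, e2'⟩ <;>
        rw [e1', e2'] <;> omega
    · obtain ⟨h1, h2⟩ := h.2 hm
      clear h
      rw [Nat.mod_eq_of_lt hm] at e1
      rw [Nat.mod_eq_of_lt (hcm.trans_lt hm)] at *
      rcases e1 with ⟨e1, e1'⟩ | ⟨e1, e1'⟩ <;> rcases e2 with ⟨e2, e2'⟩ | ⟨e2, e2'⟩ <;>
        rw [e1', e2'] <;> omega

theorem stdAt_of_add_le (N m n : ℕ) (hmn : m ≤ n) (h : m + n ≤ N + 1) (hn : n < N) :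
    StdAt N m n := by
  rw [StdAt, Nat.mod_eq_of_lt hn]
  omega

/-- `StdAt` at a modulus exceeding `n`. -/
theorem stdAt_iff_of_lt (N m n : ℕ) (hmn : m ≤ n) (hn : n < N) :
    StdAt N m n ↔ m + n ≤ N + 1 := by
  rw [StdAt, Nat.mod_eq_of_lt hn]
  omega

theorem add_mod_cases (N m n : ℕ) (hN : 0 < N) :
    (m % N + n % N < N ∧ (m + n) % N = m % N + n % N) ∨
      (N ≤ m % N + n % N ∧ (m + n) % N = m % N + n % N - N) := by
  have h1 := Nat.mod_lt m hN
  have h2 := Nat.mod_lt n hN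
  rw [Nat.add_mod]
  generalize m % N = x at *
  generalize n % N = y at *
  rcases lt_or_ge (x + y) N with h4 | h4
  · rw [Nat.mod_eq_of_lt h4]; omega
  · rw [Nat.mod_eq_sub_mod h4, Nat.mod_eq_of_lt (by omega)]; omega

theorem neg_mod_cases (N R n : ℕ) (hN : 0 < N) (hR : N ∣ R) (hn : n ≤ R) :
    (n % N = 0 ∧ (R - n) % N = 0) ∨ (0 < n % N ∧ (R - n) % N = N - n % N) := by
  have := sub_mod_cases N R n hN hn
  rw [Nat.mod_eq_zero_of_dvd hR] at this
  omega

/-- Since `m + n = R + 1`, the pair `(m - 1, n - 1)` is `(R - n, R - m)`: this is the duality behind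
the first two cases. -/
theorem stdAt_pred_iff (N R m n : ℕ) (hN : 2 ≤ N) (hR : N ∣ R) (hm : 1 ≤ m) (hn : 1 ≤ n)
    (h : m + n = R + 1) : StdAt N m n ↔ StdAt N (m - 1) (n - 1) := by
  have hN0 : 0 < N := by omega
  have h1 : (m + n) % N = 1 := by
    rw [h, Nat.add_mod, Nat.mod_eq_zero_of_dvd hR, zero_add, Nat.mod_mod,
      Nat.mod_eq_of_lt (by omega)]
  have e0 := add_mod_cases N m n hN0
  have e1 := sub_mod_cases N m 1 hN0 hm
  have e2 := sub_mod_cases N n 1 hN0 hn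
  rw [Nat.mod_eq_of_lt (show 1 < N by omega)] at e1 e2
  have hM := Nat.mod_lt m hN0
  have hD := Nat.mod_lt n hN0
  simp only [StdAt]
  rcases lt_trichotomy m N with h3 | h3 | h3
  · rw [Nat.mod_eq_of_lt h3] at *
    rw [Nat.mod_eq_of_lt (show m - 1 < N by omega)] at *
    omega
  · have : m % N = 0 := by rw [h3, Nat.mod_self]
    omega
  · omega

/-- Replacing the residue `y` of `n` by `N - y` permutes the inequalities in each branch of `StdAt`.
-/
theorem stdAt_neg_right_iff (N R m n : ℕ) (hN : 2 ≤ N) (hR : N ∣ R) (hn : n ≤ R) :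
    StdAt N m n ↔ StdAt N m (R - n) := by
  have hN0 : 0 < N := by omega
  have e := neg_mod_cases N R n hN0 hR hn
  have hM := Nat.mod_lt m hN0
  have hD := Nat.mod_lt n hN0
  simp only [StdAt]
  omega

/-! ### The six cases for the numerical criterion. -/

/-- The numerical criterion for the Jordan partition of `m * n` to be standard. -/
def StdNum (p m n : ℕ) : Prop := ∀ s, 1 ≤ s → StdAt (p ^ s) m n

section

variable {p : ℕ}

theorem two_le_pow_of_one_le (hp : 2 ≤ p) {s : ℕ} (hs : 1 ≤ s) : 2 ≤ p ^ s :=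
  hp.trans (Nat.le_self_pow (by omega) p)

theorem stdNum_pred_iff (hp : 2 ≤ p) {k R m n : ℕ} (hR : p ^ k ∣ R) (hR' : R ≤ p ^ (k + 1))
    (hm : 1 ≤ m) (hmn : m ≤ n) (hn : n < p ^ (k + 1)) (h : m + n = R + 1) :
    StdNum p m n ↔ StdNum p (m - 1) (n - 1) := by
  refine forall₂_congr fun s hs => ?_
  rcases le_or_gt s k with hsk | hsk
  · exact stdAt_pred_iff _ R m n (two_le_pow_of_one_le hp hs) ((pow_dvd_pow p hsk).trans hR) hm
      (hm.trans hmn) h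
  · have : p ^ (k + 1) ≤ p ^ s := Nat.pow_le_pow_right (by omega) hsk
    exact iff_of_true (stdAt_of_add_le _ _ _ hmn (by omega) (by omega))
      (stdAt_of_add_le _ _ _ (by omega) (by omega) (by omega))

/-- The modulus `p ^ (k + 1)` exceeds `n` and forces `m + n ≤ p ^ (k + 1) + 1`. -/
theorem stdNum_iff_of_gt (hp : 2 ≤ p) {k m n : ℕ} (hm : 1 ≤ m) (hmn : m ≤ n)
    (hn : n < p ^ (k + 1)) (h : p ^ (k + 1) < m + n) :
    StdNum p m n ↔ m + n - p ^ (k + 1) = 1 ∧ StdNum p (p ^ (k + 1) - n) (p ^ (k + 1) - m) := by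
  have key : m + n = p ^ (k + 1) + 1 → (StdNum p m n ↔
      StdNum p (p ^ (k + 1) - n) (p ^ (k + 1) - m)) := by
    intro h1
    rw [stdNum_pred_iff hp (pow_dvd_pow p (Nat.le_succ k)) le_rfl hm hmn hn h1,
      show p ^ (k + 1) - n = m - 1 by omega, show p ^ (k + 1) - m = n - 1 by omega]
  constructor
  · intro hs
    have h1 := (stdAt_iff_of_lt _ m n hmn hn).1 (hs (k + 1) (by omega))
    exact ⟨by omega, (key (by omega)).1 hs⟩
  · rintro ⟨h1, h2⟩
    exact (key (by omega)).2 h2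

variable {k a b c d : ℕ}

/-- The modulus `p ^ k` forces `c + d ≤ p ^ k + 1`, in either branch of `StdAt`. -/
theorem stdNum_iff_of_residues_gt (hp : 2 ≤ p) (hc : c < p ^ k) (hd : d < p ^ k)
    (hmn : a * p ^ k + c ≤ b * p ^ k + d) (hn : b * p ^ k + d < p ^ (k + 1))
    (hle : a * p ^ k + c + (b * p ^ k + d) ≤ p ^ (k + 1)) (h : p ^ k < c + d) :
    StdNum p (a * p ^ k + c) (b * p ^ k + d) ↔ c + d - p ^ k = 1 ∧
      StdNum p ((a + b + 1) * p ^ k - (b * p ^ k + d)) ((a + b + 1) * p ^ k - (a * p ^ k + c)) := by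
  have hR : (a + b + 1) * p ^ k = a * p ^ k + b * p ^ k + p ^ k := by ring
  have hR' : (a + b + 1) * p ^ k ≤ p ^ (k + 1) := by omega
  have key : c + d = p ^ k + 1 → (StdNum p (a * p ^ k + c) (b * p ^ k + d) ↔
      StdNum p ((a + b + 1) * p ^ k - (b * p ^ k + d))
        ((a + b + 1) * p ^ k - (a * p ^ k + c))) := by
    intro h1
    rw [stdNum_pred_iff hp (Dvd.intro_left _ rfl) hR' (by omega) hmn hn (by omega),
      show (a + b + 1) * p ^ k - (b * p ^ k + d) = a * p ^ k + c - 1 by omega,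
      show (a + b + 1) * p ^ k - (a * p ^ k + c) = b * p ^ k + d - 1 by omega]
  constructor
  · intro hs
    have hk : 1 ≤ k := by
      by_contra hk
      obtain rfl : k = 0 := by omega
      simp only [pow_zero] at *
      omega
    have h1 := hs k hk
    have e1 : (a * p ^ k + c) % p ^ k = c := by
      rw [Nat.mul_comm, Nat.mul_add_mod, Nat.mod_eq_of_lt hc]
    have e2 : (b * p ^ k + d) % p ^ k = d := by
      rw [Nat.mul_comm, Nat.mul_add_mod, Nat.mod_eq_of_lt hd]
    rw [StdAt, e1, e2] at h1
    have h2 : c + d = p ^ k + 1 := by omega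
    exact ⟨by omega, (key h2).1 hs⟩
  · rintro ⟨h1, h2⟩
    exact (key (by omega)).2 h2

theorem mul_pow_add_mod {s : ℕ} (hs : s ≤ k) (a c : ℕ) :
    (a * p ^ k + c) % p ^ s = c % p ^ s := by
  obtain ⟨t, rfl⟩ := Nat.exists_eq_add_of_le hs
  rw [pow_add, show a * (p ^ s * p ^ t) + c = p ^ s * (a * p ^ t) + c by ring, Nat.mul_add_mod]

/-- As `a > 0` gives `p ^ k ≤ m`, only the first branch of `StdAt` occurs for `s ≤ k`; larger moduli
impose nothing. -/
theorem stdNum_iff_of_pos (hp : 2 ≤ p) (ha : 0 < a)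
    (hmn : a * p ^ k + c ≤ b * p ^ k + d) (hn : b * p ^ k + d < p ^ (k + 1))
    (hle : a * p ^ k + c + (b * p ^ k + d) ≤ p ^ (k + 1)) :
    StdNum p (a * p ^ k + c) (b * p ^ k + d) ↔ ∀ s, 1 ≤ s → s ≤ k →
      c % p ^ s ≤ d % p ^ s + 1 ∧ d % p ^ s ≤ c % p ^ s + 1 ∧ c % p ^ s + d % p ^ s ≤ p ^ s + 1 ∧
        p ^ s ≤ c % p ^ s + d % p ^ s + 1 := by
  have hk : p ^ k ≤ a * p ^ k := Nat.le_mul_of_pos_left _ ha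
  refine forall₂_congr fun s hs => ?_
  rcases le_or_gt s k with hsk | hsk
  · have : p ^ s ≤ p ^ k := Nat.pow_le_pow_right (by omega) hsk
    rw [StdAt, mul_pow_add_mod hsk, mul_pow_add_mod hsk]
    constructor
    · intro h _
      exact h.1 (by omega)
    · intro h
      exact ⟨fun _ => h hsk, fun h1 => by omega⟩
  · have : p ^ (k + 1) ≤ p ^ s := Nat.pow_le_pow_right (by omega) hsk
    exact iff_of_true (stdAt_of_add_le _ _ _ hmn (by omega) (by omega)) (fun h => by omega)

theorem stdNum_iff_of_residues_le (hp : 2 ≤ p) (ha : 0 < a) (hb : 0 < b) (hc : c < p ^ k)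
    (hd : d < p ^ k) (hmn : a * p ^ k + c ≤ b * p ^ k + d) (hn : b * p ^ k + d < p ^ (k + 1))
    (hle : a * p ^ k + c + (b * p ^ k + d) ≤ p ^ (k + 1)) (h1 : 1 ≤ c + d) (h2 : c + d ≤ p ^ k) :
    StdNum p (a * p ^ k + c) (b * p ^ k + d) ↔
      StdNum p (min c d) (max c d) ∧ |(c : ℤ) - (d : ℤ)| ≤ 1 ∧
        StdNum p ((a + b) * p ^ k - (b * p ^ k + d)) ((a + b) * p ^ k - (a * p ^ k + c)) := by
  have hk : 1 ≤ k := by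
    by_contra hk
    obtain rfl : k = 0 := by omega
    simp only [pow_zero] at *
    omega
  have hQ2 := two_le_pow_of_one_le hp hk
  have hka : p ^ k ≤ a * p ^ k := Nat.le_mul_of_pos_left _ ha
  have hkb : p ^ k ≤ b * p ^ k := Nat.le_mul_of_pos_left _ hb
  rw [stdNum_iff_of_pos hp ha hmn hn hle, add_mul, abs_le,
    show a * p ^ k + b * p ^ k - (b * p ^ k + d) = a * p ^ k - d by omega,
    show a * p ^ k + b * p ^ k - (a * p ^ k + c) = b * p ^ k - c by omega]
  have hdual : ∀ s, 1 ≤ s → s ≤ k →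
      ((d % p ^ s = 0 ∧ (a * p ^ k - d) % p ^ s = 0) ∨
        (0 < d % p ^ s ∧ (a * p ^ k - d) % p ^ s = p ^ s - d % p ^ s)) ∧
      ((c % p ^ s = 0 ∧ (b * p ^ k - c) % p ^ s = 0) ∨
        (0 < c % p ^ s ∧ (b * p ^ k - c) % p ^ s = p ^ s - c % p ^ s)) := by
    intro s hs hsk
    have hdvd : ∀ t, p ^ s ∣ t * p ^ k := fun t => (pow_dvd_pow p hsk).trans (Dvd.intro_left _ rfl)
    exact ⟨neg_mod_cases _ _ d (by have := two_le_pow_of_one_le hp hs; omega) (hdvd a) (by omega),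
      neg_mod_cases _ _ c (by have := two_le_pow_of_one_le hp hs; omega) (hdvd b) (by omega)⟩
  constructor
  · intro h
    have hQ := h k hk le_rfl
    rw [Nat.mod_eq_of_lt hc, Nat.mod_eq_of_lt hd] at hQ
    refine ⟨fun s hs => ?_, by omega, fun s hs => ?_⟩
    · rcases le_or_gt s k with hsk | hsk
      · have h3 := h s hs hsk
        rcases le_total c d with hcd | hcd
        · rw [min_eq_left hcd, max_eq_right hcd]
          refine ⟨fun _ => h3, fun h4 => ?_⟩
          rw [Nat.mod_eq_of_lt h4] at h3
          omega
        · rw [min_eq_right hcd, max_eq_left hcd]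
          refine ⟨fun _ => by omega, fun h4 => ?_⟩
          rw [Nat.mod_eq_of_lt h4] at h3
          omega
      · have : p ^ k ≤ p ^ s := Nat.pow_le_pow_right (by omega) hsk.le
        exact stdAt_of_add_le _ _ _ (by omega) (by omega) (by omega)
    · rcases le_or_gt s k with hsk | hsk
      · have h3 := h s hs hsk
        obtain ⟨e1, e2⟩ := hdual s hs hsk
        have hN2 := two_le_pow_of_one_le hp hs
        refine ⟨fun _ => ?_, fun h4 => ?_⟩
        · omega
        · rw [Nat.mod_eq_of_lt h4] at e1
          omega
      · have : p ^ (k + 1) ≤ p ^ s := Nat.pow_le_pow_right (by omega) hsk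
        exact stdAt_of_add_le _ _ _ (by omega) (by omega) (by omega)
  · rintro ⟨h3, h4, h5⟩ s hs hsk
    -- The pair `(c, d)` alone does not give this lower bound; it comes from the dual pair, whose
    -- residues are those of `-d` and `-c`.
    have hQ : p ^ k ≤ c + d + 1 := by
      have h6 := h5 k hk
      obtain ⟨e1, e2⟩ := hdual k hk le_rfl
      rw [StdAt] at h6
      rw [Nat.mod_eq_of_lt hc] at e2
      rw [Nat.mod_eq_of_lt hd] at e1
      omega
    obtain ⟨t, rfl⟩ := Nat.exists_eq_add_of_le hsk
    have h6 := h3 s hs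
    have hN2 := two_le_pow_of_one_le hp hs
    rcases Nat.eq_zero_or_pos t with rfl | ht
    · rw [add_zero] at *
      rw [Nat.mod_eq_of_lt hc, Nat.mod_eq_of_lt hd]
      omega
    rcases le_or_gt (p ^ s) (min c d) with h7 | h7
    · have h8 := h6.1 h7
      rcases le_total c d with hcd | hcd
      · rw [min_eq_left hcd, max_eq_right hcd] at h8
        exact h8
      · rw [min_eq_right hcd, max_eq_left hcd] at h8
        omega
    · have h8 := h6.2 h7
      have h9 : 2 ≤ p ^ t := two_le_pow_of_one_le hp ht
      have h10 : p ^ s * 2 ≤ p ^ (s + t) := by rw [pow_add]; exact Nat.mul_le_mul_left _ h9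
      -- Here `c` and `d` differ by at most `1` and their sum is at least `2 * p ^ s - 1`, so the
      -- smaller is `p ^ s - 1` and the larger `p ^ s`. The second branch then leaves only `p ^ s =
      -- 2`.
      have h11 : max c d = p ^ s := by omega
      rw [h11, Nat.mod_self] at h8
      have h12 : p ^ s = 2 := by omega
      rw [h12] at *
      have h13 : (c = 1 ∧ d = 2) ∨ (c = 2 ∧ d = 1) := by omega
      rcases h13 with ⟨rfl, rfl⟩ | ⟨rfl, rfl⟩ <;> simp

/-- For moduli up to `p ^ k`, this is reflection in `2 * b * p ^ k`; larger moduli impose nothing.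
-/
theorem stdNum_iff_neg_right (hp : 2 ≤ p) (hb : 0 < b) (hd : d < p ^ k)
    (hn : b * p ^ k + d < p ^ (k + 1)) (h2 : c + d ≤ p ^ k) :
    StdNum p c (b * p ^ k + d) ↔ StdNum p c (b * p ^ k - d) := by
  have hkb : p ^ k ≤ b * p ^ k := Nat.le_mul_of_pos_left _ hb
  refine forall₂_congr fun s hs => ?_
  rcases le_or_gt s k with hsk | hsk
  · rw [stdAt_neg_right_iff _ (b * p ^ k + b * p ^ k) _ _ (two_le_pow_of_one_le hp hs)
      ((pow_dvd_pow p hsk).trans (dvd_add (Dvd.intro_left _ rfl) (Dvd.intro_left _ rfl)))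
      (by omega), show b * p ^ k + b * p ^ k - (b * p ^ k + d) = b * p ^ k - d by omega]
  · have : p ^ (k + 1) ≤ p ^ s := Nat.pow_le_pow_right (by omega) hsk
    have h3 : b < p := by
      by_contra h3
      have := Nat.mul_le_mul_right (p ^ k) (not_lt.1 h3)
      rw [pow_succ'] at hn
      omega
    have h4 := Nat.mul_le_mul_right (p ^ k) (Nat.succ_le_of_lt h3)
    rw [Nat.succ_mul, ← pow_succ'] at h4
    exact iff_of_true (stdAt_of_add_le _ _ _ (by omega) (by omega) (by omega))
      (stdAt_of_add_le _ _ _ (by omega) (by omega) (by omega))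

theorem stdNum_mul_pow_iff (hp : 2 ≤ p) (hc : c < p ^ k) (h1 : 1 ≤ c) :
    StdNum p c (b * p ^ k) ↔ c = 1 := by
  constructor
  · intro h
    have hk : 1 ≤ k := by
      by_contra hk
      obtain rfl : k = 0 := by omega
      simp only [pow_zero] at *
      omega
    have := (h k hk).2 hc
    rw [Nat.mul_mod_left] at this
    omega
  · rintro rfl s hs
    have h2 := two_le_pow_of_one_le hp hs
    have := Nat.mod_lt (b * p ^ k) (show 0 < p ^ s by omega)
    rw [StdAt]
    generalize b * p ^ k % p ^ s = x at *
    omega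

theorem stdNum_mul_pow_mul_pow_iff (hp : 2 ≤ p) (ha : 0 < a) (hab : a ≤ b)
    (hle : a * p ^ k + b * p ^ k ≤ p ^ (k + 1)) :
    StdNum p (a * p ^ k) (b * p ^ k) ↔ k = 0 := by
  have hka : p ^ k ≤ a * p ^ k := Nat.le_mul_of_pos_left _ ha
  constructor
  · intro h
    by_contra hk
    have h2 := two_le_pow_of_one_le hp (Nat.one_le_iff_ne_zero.2 hk)
    have := (h k (by omega)).1 hka
    rw [Nat.mul_mod_left, Nat.mul_mod_left] at this
    omega
  · rintro rfl s hs
    simp only [pow_zero, mul_one, zero_add, pow_one] at *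
    have : p ≤ p ^ s := Nat.le_self_pow (by omega) p
    exact stdAt_of_add_le _ _ _ hab (by omega) (by omega)

end

/-! ### Jordan strings and multiplication by `x + y`. -/

section

variable {K W : Type*} [Field K] [AddCommGroup W] [Module K W]

/-- Strings of a nilpotent operator are independent if their last vectors are. -/
theorem linearIndependent_strings {ι : Type*} [Fintype ι] (T : Module.End K W) (l : ι → ℕ)
    (w : ι → W) (hw : ∀ i, (T ^ l i) (w i) = 0)
    (hu : LinearIndependent K fun i => (T ^ (l i - 1)) (w i)) :
    LinearIndependent K fun x : Σ i, Fin (l i) => (T ^ (x.2 : ℕ)) (w x.1) := by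
  classical
  rw [Fintype.linearIndependent_iff]
  intro g hg
  by_contra hne
  push Not at hne
  obtain ⟨x₁, hx₁⟩ := hne
  -- Take a nonzero coefficient farthest from the end of its string, at distance `E`. Then `T ^ E`
  -- kills every term at smaller distance and sends those at distance `E` to end vectors.
  obtain ⟨x₀, hx₀, hmax⟩ := Finset.exists_max_image
    (Finset.univ.filter fun x : Σ i, Fin (l i) => g x ≠ 0) (fun x => l x.1 - 1 - x.2)
    ⟨x₁, by simpa using hx₁⟩
  simp only [Finset.mem_filter, Finset.mem_univ, true_and] at hx₀ hmax
  obtain ⟨i₀, t₀⟩ := x₀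
  set E := l i₀ - 1 - t₀ with hE
  have hzero : ∀ i k, l i ≤ k → (T ^ k) (w i) = 0 := by
    intro i k hk
    rw [← Nat.sub_add_cancel hk, pow_add, Module.End.mul_apply, hw, map_zero]
  have h1 := congrArg (T ^ E) hg
  rw [map_zero, map_sum, Fintype.sum_sigma] at h1
  have h2 : ∀ i, ∑ t : Fin (l i), (T ^ E) (g ⟨i, t⟩ • (T ^ (t : ℕ)) (w i)) =
      (if h : E < l i then g ⟨i, ⟨l i - 1 - E, by omega⟩⟩ else 0) • (T ^ (l i - 1)) (w i) := by
    intro i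
    split_ifs with h
    · rw [Finset.sum_eq_single (⟨l i - 1 - E, by omega⟩ : Fin (l i))]
      · rw [map_smul, ← Module.End.mul_apply, ← pow_add]
        simp only
        rw [show E + (l i - 1 - E) = l i - 1 by omega]
      · intro t _ ht
        rcases lt_or_ge (l i - 1 - t) E with h3 | h3
        · rw [map_smul, ← Module.End.mul_apply, ← pow_add, hzero i _ (by omega), smul_zero]
        · have : g ⟨i, t⟩ = 0 := by
            by_contra h4
            have := hmax ⟨i, t⟩ h4
            simp only at this
            apply ht
            ext
            simp only
            omega
          rw [this, zero_smul, map_zero]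
      · simp
    · rw [zero_smul]
      refine Finset.sum_eq_zero fun t _ => ?_
      rw [map_smul, ← Module.End.mul_apply, ← pow_add, hzero i _ (by omega), smul_zero]
  simp only [h2] at h1
  have h3 := Fintype.linearIndependent_iff.1 hu _ h1 i₀
  rw [dif_pos (by omega)] at h3
  apply hx₀
  rw [← h3]
  congr 2
  ext
  simp only at hE ⊢
  omega

/-- `T` acts on vectors `e i j` as multiplication by `x + y` acts on the monomials `x ^ i * y ^ j`
of `K[x, y] / (x ^ m, y ^ n)`. -/
structure IsMonomialModel (T : Module.End K W) (e : ℕ → ℕ → W) (m n : ℕ) : Prop where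
  apply : ∀ i j, T (e i j) = e (i + 1) j + e i (j + 1)
  left_zero : ∀ i j, m ≤ i → e i j = 0
  right_zero : ∀ i j, n ≤ j → e i j = 0

namespace IsMonomialModel

variable {T : Module.End K W} {e : ℕ → ℕ → W} {m n : ℕ}

theorem pow_apply (h : IsMonomialModel T e m n) (r i j : ℕ) :
    (T ^ r) (e i j) = ∑ x ∈ Finset.HasAntidiagonal.antidiagonal r, r.choose x.1 • e (i + x.1) (j + x.2) := by
  induction r with
  | zero => simp
  | succ r ih =>
    rw [pow_succ', Module.End.mul_apply, ih, map_sum,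
      Finset.sum_antidiagonal_choose_succ_nsmul (fun u v => e (i + u) (j + v)),
      ← Finset.sum_add_distrib]
    refine Finset.sum_congr rfl fun x hx => ?_
    rw [map_nsmul, h.apply, nsmul_add, add_comm]
    have : r.choose x.2 = r.choose x.1 := by
      rw [← Finset.HasAntidiagonal.mem_antidiagonal.1 hx, add_comm, Nat.choose_symm_add, add_comm]
    rw [this]
    rfl

/-- In degree `a + b + c - 1` exactly `c` monomials survive the truncation, so `(x + y) ^ (a + b)`
from degree `c - 1` is a square matrix. -/
theorem pow_apply_antidiagonal {a b c : ℕ} (h : IsMonomialModel T e (a + c) (b + c)) (i : Fin c) :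
    (T ^ (a + b)) (e i (c - 1 - i)) =
      ∑ s : Fin c, (chooseToeplitz a b c i s : K) • e (a + s) (b + c - 1 - s) := by
  have hi := i.2
  let F : ℕ → W := fun u => (if (i : ℕ) ≤ u then (a + b).choose (u - i) else 0) •
    e u (a + b + c - 1 - u)
  have h1 : (T ^ (a + b)) (e i (c - 1 - i)) = ∑ u ∈ Finset.Ico (i : ℕ) (i + (a + b + 1)), F u := by
    rw [h.pow_apply, Finset.Nat.sum_antidiagonal_eq_sum_range_succ_mk,
      Finset.sum_Ico_eq_sum_range]
    rw [Nat.add_sub_cancel_left]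
    refine Finset.sum_congr rfl fun t ht => ?_
    simp only [Finset.mem_range] at ht
    simp only [F]
    rw [if_pos (by omega), Nat.add_sub_cancel_left]
    congr 2
    omega
  have h2 : ∑ s : Fin c, (chooseToeplitz a b c i s : K) • e (a + s) (b + c - 1 - s) =
      ∑ u ∈ Finset.Ico a (a + c), F u := by
    rw [Finset.sum_Ico_eq_sum_range, Nat.add_sub_cancel_left,
      ← Fin.sum_univ_eq_sum_range (fun s => F (a + s))]
    refine Finset.sum_congr rfl fun s _ => ?_
    simp only [F, chooseToeplitz, Matrix.of_apply]
    rw [show a + b + c - 1 - (a + s) = b + c - 1 - s by omega, ← Nat.cast_smul_eq_nsmul K]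
    congr 1
    split_ifs <;> simp
  have h3 : ∀ u, u ∉ Finset.Ico a (a + c) → u < a + b + c → F u = 0 := by
    intro u hu hu2
    simp only [Finset.mem_Ico, not_and, not_lt] at hu
    rcases lt_or_ge u a with h4 | h4
    · simp only [F]
      rw [h.right_zero _ _ (by omega), smul_zero]
    · simp only [F]
      rw [h.left_zero _ _ (hu h4), smul_zero]
  have h4 : ∀ u, u ∉ Finset.Ico (i : ℕ) (i + (a + b + 1)) → F u = 0 := by
    intro u hu
    simp only [Finset.mem_Ico, not_and, not_lt] at hu
    simp only [F]
    split_ifs with h5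
    · rw [Nat.choose_eq_zero_of_lt (by have := hu h5; omega), zero_smul]
    · rw [zero_smul]
  rw [h1, h2]
  trans ∑ u ∈ Finset.range (a + b + c), F u
  · apply Finset.sum_subset
    · intro u; simp only [Finset.mem_Ico, Finset.mem_range]; omega
    · intro u _ hu; exact h4 u hu
  · symm
    apply Finset.sum_subset
    · intro u; simp only [Finset.mem_Ico, Finset.mem_range]; omega
    · intro u hu1 hu; exact h3 u hu (Finset.mem_range.1 hu1)

/-- The alternating sum of the monomials of degree `m + n - c - 1`, which is killed by `x + y`. -/
def socleVector (e : ℕ → ℕ → W) (a n c : ℕ) : W :=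
  ∑ s : Fin c, ((-1 : K) ^ (s : ℕ)) • e (a + s) (n - 1 - s)

/-- The sum telescopes, and its two end terms vanish by the truncations in `x` and in `y`. -/
theorem apply_socleVector {a c : ℕ} (h : IsMonomialModel T e (a + c) n) (hc : c ≤ n) :
    T (socleVector (K := K) e a n c) = 0 := by
  rw [socleVector, Fin.sum_univ_eq_sum_range (fun s => ((-1 : K) ^ s) • e (a + s) (n - 1 - s)),
    map_sum]
  have h1 : ∀ s ∈ Finset.range c, T (((-1 : K) ^ s) • e (a + s) (n - 1 - s)) =
      ((-1 : K) ^ s) • e (a + s) (n - s) - ((-1 : K) ^ (s + 1)) • e (a + (s + 1)) (n - (s + 1)) := by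
    intro s hs
    have := Finset.mem_range.1 hs
    rw [map_smul, h.apply, pow_succ, show n - 1 - s + 1 = n - s by omega,
      show n - 1 - s = n - (s + 1) by omega, smul_add, ← add_assoc]
    simp only [mul_neg, mul_one, neg_smul, sub_neg_eq_add]
    rw [add_comm]
  rw [Finset.sum_congr rfl h1, Finset.sum_range_sub' (fun s => ((-1 : K) ^ s) • e (a + s) (n - s)),
    h.left_zero _ _ le_rfl, h.right_zero _ _ (by omega)]
  simp

theorem linearIndependent_socleVector (B : Module.Basis (Fin m × Fin n) K W)
    (hB : ∀ x, B x = e x.1 x.2) (hmn : m ≤ n) :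
    LinearIndependent K fun j : Fin m => socleVector (K := K) e (m - (j + 1)) n (j + 1) := by
  rw [Fintype.linearIndependent_iff]
  intro g hg j
  have hj := j.2
  -- The monomial at `s = 0` in the `j`-th vector; the vectors have distinct degrees, so it occurs
  -- in no other.
  let x₀ : Fin m × Fin n := (⟨m - (j + 1), by omega⟩, ⟨n - 1, by omega⟩)
  have hcoord : ∀ j' : Fin m, B.coord x₀
      (socleVector (K := K) e (m - (j' + 1)) n (j' + 1)) = if j' = j then 1 else 0 := by
    intro j'
    have he : ∀ x y (hx : x < m) (hy : y < n), e x y = B (⟨x, hx⟩, ⟨y, hy⟩) :=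
      fun x y hx hy => (hB (⟨x, hx⟩, ⟨y, hy⟩)).symm
    rw [socleVector, map_sum]
    have h1 : ∀ s : Fin (j' + 1), B.coord x₀
        ((-1 : K) ^ (s : ℕ) • e (m - (j' + 1) + s) (n - 1 - s)) =
        if s = 0 then (if j' = j then 1 else 0) else 0 := by
      intro s
      have hs := s.2
      have hj' := j'.2
      rw [he _ _ (by omega) (by omega), map_smul, Module.Basis.coord_apply, B.repr_self,
        Finsupp.single_apply]
      by_cases hs : s = 0
      · subst hs
        simp only [x₀, Fin.val_zero, pow_zero, one_smul, if_true, Prod.mk.injEq, Fin.mk.injEq]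
        congr 1
        rw [eq_iff_iff, Fin.ext_iff]
        omega
      · have : (s : ℕ) ≠ 0 := fun h => hs (Fin.ext h)
        rw [if_neg hs, if_neg, smul_zero]
        simp only [x₀, Prod.mk.injEq, Fin.mk.injEq]
        omega
    simp [h1]
  have h2 := congrArg (B.coord x₀) hg
  rw [map_sum, map_zero] at h2
  simp only [map_smul, hcoord] at h2
  simpa using h2

theorem sum_standard_parts (m n : ℕ) (hmn : m ≤ n) :
    ∑ j : Fin m, (m + n - 1 - 2 * (j : ℕ)) = m * n := by
  rw [Fin.sum_univ_eq_sum_range (fun j => m + n - 1 - 2 * j)]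
  obtain ⟨k, rfl⟩ := Nat.exists_eq_add_of_le hmn
  clear hmn
  induction m with
  | zero => simp
  | succ m ih =>
    rw [Finset.sum_range_succ', show m + 1 + (m + 1 + k) - 1 - 2 * 0 = 2 * m + k + 1 by omega,
      Finset.sum_congr rfl (g := fun j => m + (m + k) - 1 - 2 * j) (fun j _ => by omega), ih]
    ring

/-- Inverting the Toeplitz matrix gives a preimage of each socle vector under `T ^ (m + n - 2 * c)`,
which starts a string of length `m + n - 2 * c + 1`; here `c = j + 1`. -/
theorem exists_strings (h : IsMonomialModel T e m n) (hmn : m ≤ n)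
    (B : Module.Basis (Fin m × Fin n) K W) (hB : ∀ x, B x = e x.1 x.2)
    (hdet : ∀ c, 1 ≤ c → c ≤ m → ((chooseToeplitz (m - c) (n - c) c).det : K) ≠ 0) :
    ∃ w : Fin m → W, (∀ j : Fin m, (T ^ (m + n - 1 - 2 * (j : ℕ))) (w j) = 0) ∧
      (LinearIndependent K fun x : Σ j : Fin m, Fin (m + n - 1 - 2 * (j : ℕ)) =>
        (T ^ (x.2 : ℕ)) (w x.1)) := by
  have h1 : ∀ c, 1 ≤ c → c ≤ m → ∃ w, (T ^ (m + n - 2 * c)) w =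
      socleVector (K := K) e (m - c) n c := by
    intro c hc1 hcm
    have hd := hdet c hc1 hcm
    clear hdet hB B
    obtain ⟨a, rfl⟩ := Nat.exists_eq_add_of_le' hcm
    obtain ⟨b, rfl⟩ := Nat.exists_eq_add_of_le' (hcm.trans hmn)
    rw [Nat.add_sub_cancel, Nat.add_sub_cancel] at hd
    rw [Nat.add_sub_cancel, show a + c + (b + c) - 2 * c = a + b by omega]
    set M := (chooseToeplitz a b c).map (Int.castRingHom K) with hM
    have hd' : IsUnit M.det := by
      rw [hM, ← RingHom.mapMatrix_apply, ← RingHom.map_det]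
      exact isUnit_iff_ne_zero.2 hd
    let v : Fin c → K := fun s => (-1) ^ (s : ℕ)
    let f := Matrix.vecMul v M⁻¹
    have hf : Matrix.vecMul f M = v := by
      rw [Matrix.vecMul_vecMul, Matrix.nonsing_inv_mul _ hd', Matrix.vecMul_one]
    refine ⟨∑ i : Fin c, f i • e i (c - 1 - i), ?_⟩
    rw [map_sum, socleVector]
    simp only [map_smul, h.pow_apply_antidiagonal, Finset.smul_sum]
    rw [Finset.sum_comm]
    refine Finset.sum_congr rfl fun s _ => ?_
    have := congrFun hf s
    rw [Matrix.vecMul, dotProduct] at this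
    simp only [smul_smul, ← Finset.sum_smul]
    rw [show (-1 : K) ^ (s : ℕ) = v s from rfl, ← this]
    rfl
  have h2 : ∀ j : Fin m, ∃ w, (T ^ (m + n - 1 - 2 * (j : ℕ) - 1)) w =
      socleVector (K := K) e (m - (j + 1)) n (j + 1) := by
    intro j
    rw [show m + n - 1 - 2 * (j : ℕ) - 1 = m + n - 2 * (j + 1) by omega]
    exact h1 (j + 1) (by omega) (by omega)
  choose w hw using h2
  have hw0 : ∀ j : Fin m, (T ^ (m + n - 1 - 2 * (j : ℕ))) (w j) = 0 := by
    intro j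
    have hj := j.2
    rw [show m + n - 1 - 2 * (j : ℕ) = m + n - 1 - 2 * (j : ℕ) - 1 + 1 by omega, pow_succ',
      Module.End.mul_apply, hw]
    refine apply_socleVector ?_ (by omega)
    rwa [Nat.sub_add_cancel (by omega)]
  refine ⟨w, hw0, linearIndependent_strings T _ w hw0 ?_⟩
  simp only [hw]
  exact linearIndependent_socleVector B hB hmn

/-- A rank bound by degree: `c * (c - 1) / 2` images from degrees below `c - 1`; only `c - 1` from
degree `c - 1`, because of the relation `f`; and all higher degrees land among the top `c * (c - 1)
/ 2` monomials. The total is `c ^ 2 - 1`. -/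
theorem range_pow_le_span {a b c : ℕ} (h : IsMonomialModel T e (a + c) (b + c))
    (B : Module.Basis (Fin (a + c) × Fin (b + c)) K W) (hB : ∀ x, B x = e x.1 x.2)
    (f : Fin c → K) (i₀ : Fin c) (hf0 : f i₀ ≠ 0)
    (hf : ∑ i, f i • (T ^ (a + b)) (e i (c - 1 - i)) = 0) :
    LinearMap.range (T ^ (a + b)) ≤ Submodule.span K (Set.range
      (Sum.elim (fun x : Σ k : Fin (c - 1), Fin (k + 1) => (T ^ (a + b)) (e x.2 (x.1 - x.2)))
        (Sum.elim (fun i : {i : Fin c // i ≠ i₀} => (T ^ (a + b)) (e i (c - 1 - i)))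
          fun x : Σ k : Fin (c - 1), Fin (k + 1) =>
            e (a + c - 1 - x.2) (b + c - 1 - (x.1 - x.2))))) := by
  classical
  set S := Submodule.span K (Set.range
      (Sum.elim (fun x : Σ k : Fin (c - 1), Fin (k + 1) => (T ^ (a + b)) (e x.2 (x.1 - x.2)))
        (Sum.elim (fun i : {i : Fin c // i ≠ i₀} => (T ^ (a + b)) (e i (c - 1 - i)))
          fun x : Σ k : Fin (c - 1), Fin (k + 1) =>
            e (a + c - 1 - x.2) (b + c - 1 - (x.1 - x.2))))) with hS
  have hlow : ∀ x y, x + y < c - 1 → (T ^ (a + b)) (e x y) ∈ S := by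
    intro x y hxy
    refine Submodule.subset_span ⟨Sum.inl ⟨⟨x + y, hxy⟩, ⟨x, by simp only; omega⟩⟩, ?_⟩
    simp
  have hmid' : ∀ i : Fin c, i ≠ i₀ → (T ^ (a + b)) (e i (c - 1 - i)) ∈ S := fun i hi =>
    Submodule.subset_span ⟨Sum.inr (Sum.inl ⟨i, hi⟩), rfl⟩
  have hmid : ∀ i : Fin c, (T ^ (a + b)) (e i (c - 1 - i)) ∈ S := by
    intro i
    by_cases hi : i = i₀
    · subst hi
      rw [← Finset.add_sum_erase _ _ (Finset.mem_univ i)] at hf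
      rw [← Submodule.smul_mem_iff S hf0, eq_neg_of_add_eq_zero_left hf]
      exact S.neg_mem (S.sum_mem fun j hj => S.smul_mem _ (hmid' j (Finset.ne_of_mem_erase hj)))
    · exact hmid' i hi
  have hhigh' : ∀ x y, a + b + c ≤ x + y → e x y ∈ S := by
    intro x y hxy
    rcases le_or_gt (a + c) x with hx | hx
    · rw [h.left_zero _ _ hx]; exact S.zero_mem
    rcases le_or_gt (b + c) y with hy | hy
    · rw [h.right_zero _ _ hy]; exact S.zero_mem
    refine Submodule.subset_span ⟨Sum.inr (Sum.inr ⟨⟨a + b + c + c - 2 - x - y, by omega⟩,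
      ⟨a + c - 1 - x, by simp only; omega⟩⟩), ?_⟩
    simp only [Sum.elim_inr]
    congr 1 <;> omega
  have hhigh : ∀ x y, c ≤ x + y → (T ^ (a + b)) (e x y) ∈ S := by
    intro x y hxy
    rw [h.pow_apply]
    refine S.sum_mem fun z hz => S.nsmul_mem (hhigh' _ _ ?_) _
    have := Finset.HasAntidiagonal.mem_antidiagonal.1 hz
    omega
  rw [LinearMap.range_eq_map, ← B.span_eq, Submodule.map_span_le]
  rintro _ ⟨x, rfl⟩
  rw [hB]
  obtain ⟨⟨x, hx⟩, ⟨y, hy⟩⟩ := x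
  simp only
  rcases lt_trichotomy (x + y) (c - 1) with h1 | h1 | h1
  · exact hlow x y h1
  · rcases Nat.eq_zero_or_pos c with rfl | hc
    · exact i₀.elim0
    have := hmid ⟨x, by omega⟩
    simp only at this
    rwa [show c - 1 - x = y by omega] at this
  · exact hhigh x y (by omega)

/-- Standard strings give `T ^ (a + b)` rank at least `∑ j < c, (2 * c - 1 - 2 * j) = c ^ 2`, one
more than `range_pow_le_span` allows if the determinant vanishes. -/
theorem det_ne_zero_of_strings (h : IsMonomialModel T e m n) (hmn : m ≤ n)
    (B : Module.Basis (Fin m × Fin n) K W) (hB : ∀ x, B x = e x.1 x.2) (w : Fin m → W)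
    (hw : LinearIndependent K fun x : Σ j : Fin m, Fin (m + n - 1 - 2 * (j : ℕ)) =>
        (T ^ (x.2 : ℕ)) (w x.1)) (c : ℕ) (hcm : c ≤ m) :
    ((chooseToeplitz (m - c) (n - c) c).det : K) ≠ 0 := by
  classical
  obtain ⟨a, rfl⟩ := Nat.exists_eq_add_of_le' hcm
  obtain ⟨b, rfl⟩ := Nat.exists_eq_add_of_le' (hcm.trans hmn)
  rw [Nat.add_sub_cancel, Nat.add_sub_cancel]
  intro h0
  set M := (chooseToeplitz a b c).map (Int.castRingHom K) with hM
  have hd' : M.det = 0 := by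
    rw [hM, ← RingHom.mapMatrix_apply, ← RingHom.map_det]
    exact h0
  obtain ⟨f, hf0, hf⟩ := Matrix.exists_vecMul_eq_zero_iff.2 hd'
  obtain ⟨i₀, hi₀⟩ := Function.ne_iff.1 hf0
  have hfT : ∑ i, f i • (T ^ (a + b)) (e i (c - 1 - i)) = 0 := by
    simp only [h.pow_apply_antidiagonal, Finset.smul_sum]
    rw [Finset.sum_comm]
    refine Finset.sum_eq_zero fun s _ => ?_
    have := congrFun hf s
    rw [Matrix.vecMul, dotProduct] at this
    simp only [smul_smul, ← Finset.sum_smul]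
    simp only [hM, Matrix.map_apply] at this
    rw [show ∑ i, f i * (chooseToeplitz a b c i s : K) = 0 from this, zero_smul]
  have hle := range_pow_le_span h B hB f i₀ hi₀ hfT
  have : FiniteDimensional K W := B.finiteDimensional_of_finite
  have h1 := (Submodule.finrank_mono hle).trans (finrank_range_le_card _)
  let v : (Σ j : Fin c, Fin (2 * c - 1 - 2 * (j : ℕ))) → LinearMap.range (T ^ (a + b)) := fun x =>
    ⟨(T ^ (a + b + x.2)) (w (Fin.castLE hcm x.1)), by
      rw [pow_add T (a + b), Module.End.mul_apply]; exact ⟨_, rfl⟩⟩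
  let φ : (Σ j : Fin c, Fin (2 * c - 1 - 2 * (j : ℕ))) →
      Σ j : Fin (a + c), Fin (a + c + (b + c) - 1 - 2 * (j : ℕ)) := fun x =>
    ⟨Fin.castLE hcm x.1, ⟨a + b + x.2, by have := x.2.2; simp only [Fin.val_castLE]; omega⟩⟩
  have hφ : Function.Injective φ := by
    rintro ⟨⟨x, hx⟩, ⟨y, hy⟩⟩ ⟨⟨x', hx'⟩, ⟨y', hy'⟩⟩ hxy
    simp only [φ, Sigma.mk.injEq, Fin.castLE_mk, Fin.mk.injEq] at hxy
    obtain ⟨rfl, h2⟩ := hxy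
    simpa using h2
  have hv : LinearIndependent K v := by
    apply LinearIndependent.of_comp (LinearMap.range (T ^ (a + b))).subtype
    exact hw.comp φ hφ
  have h2 := hv.fintype_card_le_finrank
  have h3 := h2.trans h1
  have hs : ∀ c : ℕ, ∑ j : Fin c, (2 * c - 1 - 2 * (j : ℕ)) = c * c := by
    intro c
    have := sum_standard_parts c c le_rfl
    rwa [← two_mul] at this
  have hg : (∑ k : Fin (c - 1), ((k : ℕ) + 1)) * 2 = c * (c - 1) := by
    rw [Fin.sum_univ_eq_sum_range (fun k => k + 1), ← Finset.sum_range_id_mul_two]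
    rcases Nat.eq_zero_or_pos c with rfl | hc
    · simp
    · obtain ⟨d, rfl⟩ := Nat.exists_eq_add_of_lt hc
      simp [Finset.sum_range_succ']
  have hc : 0 < c := i₀.pos
  simp only [Fintype.card_sigma, Fintype.card_fin, Fintype.card_sum, hs,
    Fintype.card_subtype_compl, Fintype.card_unique] at h3
  obtain ⟨d, rfl⟩ := Nat.exists_eq_add_of_lt hc
  simp only [zero_add, Nat.add_sub_cancel] at *
  nlinarith

end IsMonomialModel

end

/-! ### Nilpotent blocks, their tensor products and direct sums. -/

section

open scoped TensorProduct DirectSum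

variable {K : Type*} [Field K]

section

variable {W : Type*} [AddCommGroup W] [Module K W]

/-- The operator `N` on a space of dimension `d` is a single nilpotent Jordan block with cyclic
vector `v`. -/
structure IsNilpotentBlock (N : Module.End K W) (d : ℕ) (v : W) : Prop where
  pow_eq_zero : N ^ d = 0
  linearIndependent : LinearIndependent K fun t : Fin d => (N ^ (t : ℕ)) v

/-- The system for `g` is triangular: testing against `N ^ (k - 1 - t)` isolates `g t` once the
earlier coefficients vanish. -/
theorem eq_zero_of_forall_dual_pow_eq_zero (N : Module.End K W) (k : ℕ) (hN : N ^ k = 0) (v : W)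
    (φ : Module.Dual K W) (hφ : φ ((N ^ (k - 1)) v) ≠ 0) (g : Fin k → K)
    (hg : ∀ t : Fin k, φ ((N ^ (t : ℕ)) (∑ s, g s • (N ^ (s : ℕ)) v)) = 0) (t : Fin k) :
    g t = 0 := by
  obtain ⟨t, ht⟩ := t
  induction t using Nat.strong_induction_on with
  | _ t ih =>
    have h := hg ⟨k - 1 - t, by omega⟩
    rw [map_sum, map_sum, Finset.sum_eq_single ⟨t, ht⟩] at h
    · rw [map_smul, ← Module.End.mul_apply, ← pow_add, map_smul] at h
      simp only at h
      rw [Nat.sub_add_cancel (by omega), smul_eq_mul] at h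
      exact (mul_eq_zero.1 h).resolve_right hφ
    · rintro ⟨s, hs⟩ _ hst
      have hst' : s ≠ t := fun h => hst (Fin.ext h)
      rw [map_smul, ← Module.End.mul_apply, ← pow_add, map_smul]
      simp only
      rcases lt_or_gt_of_ne hst' with h1 | h1
      · rw [ih s h1 hs, zero_smul]
      · rw [show k - 1 - t + s = s - t - 1 + k by omega, pow_add, hN, mul_zero,
          LinearMap.zero_apply, map_zero, smul_zero]
    · simp

/-- A cyclic subspace of maximal length `k` has a stable complement, namely the common kernel of the
functionals `φ ∘ N ^ t`, of codimension at most `k`. Indecomposability makes this complement zero.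
-/
theorem exists_isNilpotentBlock [FiniteDimensional K W] [Nontrivial W] (N : Module.End K W)
    (hN : IsNilpotent N)
    (h : ∀ A B : Submodule K W, (∀ x ∈ A, N x ∈ A) → (∀ x ∈ B, N x ∈ B) → IsCompl A B →
      A = ⊥ ∨ B = ⊥) : ∃ v, IsNilpotentBlock N (Module.finrank K W) v := by
  set k := nilpotencyClass N with hk
  have hNk : N ^ k = 0 := pow_nilpotencyClass hN
  have hk0 : 0 < k := pos_nilpotencyClass_iff.2 hN
  have hNk1 : N ^ (k - 1) ≠ 0 := pow_pred_nilpotencyClass hN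
  obtain ⟨v, hv⟩ : ∃ v, (N ^ (k - 1)) v ≠ 0 := by
    by_contra hc
    push Not at hc
    exact hNk1 (LinearMap.ext hc)
  obtain ⟨φ, hφ⟩ : ∃ φ : Module.Dual K W, φ ((N ^ (k - 1)) v) ≠ 0 := by
    by_contra hc
    push Not at hc
    exact hv ((Module.forall_dual_apply_eq_zero_iff K _).1 hc)
  have key := eq_zero_of_forall_dual_pow_eq_zero N k hNk v φ hφ
  have hli : LinearIndependent K fun t : Fin k => (N ^ (t : ℕ)) v := by
    rw [Fintype.linearIndependent_iff]
    intro g hg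
    exact key g fun t => by rw [hg, map_zero, map_zero]
  let A := Submodule.span K (Set.range fun t : Fin k => (N ^ (t : ℕ)) v)
  let Φ : W →ₗ[K] (Fin k → K) := LinearMap.pi fun t => φ ∘ₗ (N ^ (t : ℕ))
  have hA : ∀ x ∈ A, N x ∈ A := by
    intro x hx
    have : A ≤ A.comap N := by
      refine Submodule.span_le.2 ?_
      rintro _ ⟨t, rfl⟩
      rw [SetLike.mem_coe, Submodule.mem_comap, ← Module.End.mul_apply, ← pow_succ']
      rcases lt_or_ge ((t : ℕ) + 1) k with h1 | h1
      · exact Submodule.subset_span ⟨⟨t + 1, h1⟩, rfl⟩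
      · rw [show (t : ℕ) + 1 = k by omega, hNk]
        exact A.zero_mem
    exact this hx
  have hΦ : ∀ x, x ∈ LinearMap.ker Φ ↔ ∀ t : Fin k, φ ((N ^ (t : ℕ)) x) = 0 := by
    intro x
    rw [LinearMap.mem_ker, funext_iff]
    rfl
  have hB : ∀ x ∈ LinearMap.ker Φ, N x ∈ LinearMap.ker Φ := by
    intro x hx
    rw [hΦ] at hx ⊢
    intro t
    rw [← Module.End.mul_apply, ← pow_succ]
    rcases lt_or_ge ((t : ℕ) + 1) k with h1 | h1
    · exact hx ⟨t + 1, h1⟩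
    · rw [show (t : ℕ) + 1 = k by omega, hNk, LinearMap.zero_apply, map_zero]
  have hdisj : Disjoint A (LinearMap.ker Φ) := by
    rw [Submodule.disjoint_def]
    intro x hxA hxB
    obtain ⟨g, rfl⟩ := (Submodule.mem_span_range_iff_exists_fun K).1 hxA
    rw [hΦ] at hxB
    exact Finset.sum_eq_zero fun t _ => by rw [key g hxB t, zero_smul]
  have hfA : Module.finrank K A = k := by
    rw [finrank_span_eq_card hli, Fintype.card_fin]
  have hfB := Φ.finrank_range_add_finrank_ker
  have hfR := Submodule.finrank_le (LinearMap.range Φ)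
  rw [Module.finrank_fin_fun] at hfR
  have htop := Submodule.eq_top_of_disjoint A (LinearMap.ker Φ) (by omega) hdisj
  have hAne : A ≠ ⊥ := by
    intro hbot
    rw [hbot, finrank_bot] at hfA
    omega
  have hBbot := (h A (LinearMap.ker Φ) hA hB ⟨hdisj, codisjoint_iff.2 htop⟩).resolve_left hAne
  rw [hBbot, sup_bot_eq] at htop
  rw [htop, finrank_top] at hfA
  rw [hfA]
  exact ⟨v, hNk, hli⟩

theorem sub_one_pow_eq_zero {p : ℕ} (hp : p.Prime) [CharP K p] (A : Module.End K W) (α : ℕ)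
    (hA : A ^ p ^ α = 1) : (A - 1) ^ p ^ α = 0 := by
  have := Fact.mk hp
  have h : (Polynomial.X - 1 : Polynomial K) ^ p ^ α = Polynomial.X ^ p ^ α - 1 := by
    rw [sub_pow_char_pow, one_pow]
  have h2 := congrArg (Polynomial.aeval A) h
  simpa [hA] using h2

end

section

variable {V W : Type*} [AddCommGroup V] [Module K V] [AddCommGroup W] [Module K W]

/-- Vectors of a tensor product of two unipotent Jordan blocks, on which the difference of the
diagonal action and the identity acts as `x + y` on monomials. -/
def tensorMonomial (A : Module.End K V) (v : V) (B : Module.End K W) (w : W) (i j : ℕ) :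
    V ⊗[K] W :=
  (((A - 1) ^ i * A ^ j) v) ⊗ₜ[K] (((B - 1) ^ j) w)

/-- Use `A ⊗ B - 1 = (A - 1) ⊗ 1 + A ⊗ (B - 1)`. The factor `A ^ j` in `tensorMonomial` absorbs the
`A` of the second summand, so the operator becomes exactly `x + y`. -/
theorem isMonomialModel_tensorMonomial {A : Module.End K V} {v : V} {B : Module.End K W} {w : W}
    {m n : ℕ} (hA : (A - 1) ^ m = 0) (hB : (B - 1) ^ n = 0) :
    IsMonomialModel (TensorProduct.map A B - 1) (tensorMonomial A v B w) m n where
  apply i j := by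
    have hc : A * (A - 1) ^ i = (A - 1) ^ i * A :=
      (((Commute.refl A).sub_right (Commute.one_right A)).pow_right i).eq
    have h1 : ((A - 1) ^ (i + 1) * A ^ j) v =
        A (((A - 1) ^ i * A ^ j) v) - ((A - 1) ^ i * A ^ j) v := by
      rw [pow_succ', mul_assoc, Module.End.mul_apply, LinearMap.sub_apply, Module.End.one_apply]
    have h2 : ((A - 1) ^ i * A ^ (j + 1)) v = A (((A - 1) ^ i * A ^ j) v) := by
      rw [← Module.End.mul_apply, ← mul_assoc, hc, mul_assoc, pow_succ']
    have h3 : ((B - 1) ^ (j + 1)) w = B (((B - 1) ^ j) w) - ((B - 1) ^ j) w := by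
      rw [pow_succ', Module.End.mul_apply, LinearMap.sub_apply, Module.End.one_apply]
    simp only [tensorMonomial, h1, h2, h3, LinearMap.sub_apply, TensorProduct.map_tmul,
      Module.End.one_apply, TensorProduct.sub_tmul, TensorProduct.tmul_sub]
    abel
  left_zero i j h := by
    rw [tensorMonomial, ← Nat.sub_add_cancel h, pow_add, hA]
    simp
  right_zero i j h := by
    rw [tensorMonomial, ← Nat.sub_add_cancel h, pow_add (B - 1), hB]
    simp

/-- Expand along the basis of the right factor: the `j`-th component carries the string of `v` moved
by the injective map `A ^ j`. -/
theorem linearIndependent_tensorMonomial {A : Module.End K V} {v : V} {B : Module.End K W} {w : W}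
    {m n : ℕ} (hA : IsNilpotentBlock (A - 1) m v) (hA' : Function.Injective A)
    (bW : Module.Basis (Fin n) K W) (hbW : ∀ j, bW j = ((B - 1) ^ (j : ℕ)) w) :
    LinearIndependent K fun x : Fin m × Fin n => tensorMonomial A v B w x.1 x.2 := by
  have h1 : ∀ j : Fin n, LinearIndependent K fun i : Fin m =>
      ((A - 1) ^ (i : ℕ) * A ^ (j : ℕ)) v := by
    intro j
    have hinj : Function.Injective (A ^ (j : ℕ)) := by
      rw [Module.End.coe_pow]
      exact hA'.iterate _
    have := hA.linearIndependent.map' (A ^ (j : ℕ)) (LinearMap.ker_eq_bot.2 hinj)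
    convert! this using 2 with i
    have hc : A ^ (j : ℕ) * (A - 1) ^ (i : ℕ) = (A - 1) ^ (i : ℕ) * A ^ (j : ℕ) :=
      (((Commute.refl A).sub_right (Commute.one_right A)).pow_pow _ _).eq
    rw [Function.comp_apply, ← Module.End.mul_apply, hc]
  have h2 := (Finsupp.linearIndependent_single (R := K) (ι := Fin n) (M := V)
    (fun j (i : Fin m) => ((A - 1) ^ (i : ℕ) * A ^ (j : ℕ)) v) h1).comp
    (fun x : Fin m × Fin n => (⟨x.2, x.1⟩ : Σ _ : Fin n, Fin m)) (by
      rintro ⟨a, b⟩ ⟨c, d⟩ h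
      simp only [Sigma.mk.injEq, heq_eq_eq] at h
      exact Prod.ext h.2 h.1)
  refine LinearIndependent.of_comp
    (TensorProduct.equivFinsuppOfBasisRight (M := V) bW).toLinearMap ?_
  convert! h2 using 2 with x
  simp only [tensorMonomial, ← hbW]
  ext j
  simp [Finsupp.single_apply]

end

section

variable {W : Type*} [AddCommGroup W] [Module K W] {ι : Type*}
  {U : ι → Type*} [∀ i, AddCommGroup (U i)] [∀ i, Module K (U i)]

theorem lmap_sub_one_pow_lof [DecidableEq ι] (A : ∀ i, Module.End K (U i)) (t : ℕ) (i : ι)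
    (x : U i) : ((DirectSum.lmap A - 1 : Module.End K (⨁ i, U i)) ^ t) (DirectSum.lof K ι U i x) =
      DirectSum.lof K ι U i (((A i - 1) ^ t) x) := by
  induction t with
  | zero => simp
  | succ t ih =>
    rw [pow_succ', Module.End.mul_apply, ih, pow_succ', Module.End.mul_apply]
    simp [LinearMap.sub_apply]

theorem linearIndependent_lof [DecidableEq ι] {l : ι → ℕ} (A : ∀ i, Module.End K (U i))
    (v : ∀ i, U i) (hv : ∀ i, IsNilpotentBlock (A i - 1) (l i) (v i)) :
    LinearIndependent K fun x : Σ i, Fin (l i) =>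
      ((DirectSum.lmap A - 1 : Module.End K (⨁ i, U i)) ^ (x.2 : ℕ))
        (DirectSum.lof K ι U x.1 (v x.1)) := by
  simp only [lmap_sub_one_pow_lof]
  exact DFinsupp.linearIndependent_single (R := K) (fun i (t : Fin (l i)) =>
    ((A i - 1) ^ (t : ℕ)) (v i)) fun i => (hv i).linearIndependent

/-- Both sides have a basis of strings of the same lengths; matching these bases intertwines the
operators. -/
theorem exists_linearEquiv_lmap [Fintype ι] [DecidableEq ι] [FiniteDimensional K W]
    [∀ i, FiniteDimensional K (U i)] {l : ι → ℕ}
    (A : ∀ i, Module.End K (U i)) (v : ∀ i, U i)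
    (hv : ∀ i, IsNilpotentBlock (A i - 1) (l i) (v i)) (hU : ∀ i, Module.finrank K (U i) = l i)
    (T : Module.End K W) (w : ι → W) (hw : ∀ i, ((T - 1) ^ l i) (w i) = 0)
    (hli : LinearIndependent K fun x : Σ i, Fin (l i) => ((T - 1) ^ (x.2 : ℕ)) (w x.1))
    (hW : Module.finrank K W = ∑ i, l i) :
    ∃ E : W ≃ₗ[K] ⨁ i, U i, ∀ x, E (T x) = DirectSum.lmap A (E x) := by
  let B₁ := basisOfLinearIndependentOfCardEqFinrank' _ hli (by simp [hW])
  have hfin : Module.finrank K (⨁ i, U i) = ∑ i, l i := by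
    rw [Module.finrank_directSum]
    simp [hU]
  have hFD : FiniteDimensional K (⨁ i, U i) :=
    Module.Finite.of_surjective (DirectSum.linearEquivFunOnFintype K ι U).symm.toLinearMap
      (LinearEquiv.surjective _)
  let B₂ := basisOfLinearIndependentOfCardEqFinrank' _ (linearIndependent_lof A v hv)
    (by simp [hfin])
  have hB₁ : ∀ x, B₁ x = ((T - 1) ^ (x.2 : ℕ)) (w x.1) := fun x => by
    simp [B₁]
  have hB₂ : ∀ x, B₂ x = ((DirectSum.lmap A - 1 : Module.End K (⨁ i, U i)) ^ (x.2 : ℕ))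
        (DirectSum.lof K ι U x.1 (v x.1)) := fun x => by
    simp [B₂]
  let E := B₁.equiv B₂ (Equiv.refl _)
  have hE : ∀ x, E (B₁ x) = B₂ x := fun x => by simp [E]
  have hmain : E.toLinearMap ∘ₗ (T - 1) =
      (DirectSum.lmap A - 1 : Module.End K (⨁ i, U i)) ∘ₗ E.toLinearMap := by
    refine B₁.ext ?_
    rintro ⟨i, t⟩
    simp only [LinearMap.comp_apply, LinearEquiv.coe_coe]
    rw [hE, hB₁, hB₂, ← Module.End.mul_apply, ← Module.End.mul_apply, ← pow_succ', ← pow_succ']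
    simp only
    rcases lt_or_ge ((t : ℕ) + 1) (l i) with h | h
    · have h1 := hE ⟨i, ⟨t + 1, h⟩⟩
      rwa [hB₁, hB₂] at h1
    · rw [show (t : ℕ) + 1 = l i by omega, hw, lmap_sub_one_pow_lof, (hv i).pow_eq_zero]
      simp
  refine ⟨E, fun x => ?_⟩
  have := LinearMap.congr_fun hmain x
  simpa using this

end

end

/-! ### Representations of the cyclic group and the determinant criterion. -/

section

open scoped TensorProduct DirectSum

variable {K G : Type*} [Field K] [Group G]

theorem Representation.exists_isNilpotentBlock {p : ℕ} (hp : p.Prime) [CharP K p] {W : Type*}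
    [AddCommGroup W] [Module K W] [FiniteDimensional K W] (σ : Representation K G W) {g : G}
    (hg : ∀ h : G, ∃ t : ℕ, g ^ t = h) {α : ℕ} (hα : g ^ p ^ α = 1)
    (h : IsIndecomposableRep σ) : ∃ v, IsNilpotentBlock (σ g - 1) (Module.finrank K W) v := by
  have := h.1
  refine _root_.exists_isNilpotentBlock (σ g - 1)
    ⟨p ^ α, sub_one_pow_eq_zero hp _ _ (by rw [← map_pow, hα, map_one])⟩ fun A B hA hB hAB => ?_
  -- Every element of `G` is a power of `g`, so stability under `g - 1` is stability under `G`.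
  have hsub : ∀ A : Submodule K W, (∀ x ∈ A, (σ g - 1) x ∈ A) → ∀ (h : G) ⦃x : W⦄, x ∈ A →
      σ h x ∈ A := by
    intro A hA h x hx
    obtain ⟨t, rfl⟩ := hg h
    induction t with
    | zero => simpa using hx
    | succ t ih =>
      have h1 := A.add_mem (hA _ ih) ih
      rw [LinearMap.sub_apply, Module.End.one_apply, sub_add_cancel] at h1
      rwa [pow_succ', map_mul, Module.End.mul_apply]
  exact h.2 ⟨A, hsub A hA⟩ ⟨B, hsub B hB⟩ hAB

theorem isNilpotentBlock_of_subsingleton {W : Type*} [AddCommGroup W] [Module K W]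
    [Subsingleton W] (N : Module.End K W) : IsNilpotentBlock N 0 (0 : W) where
  pow_eq_zero := Subsingleton.elim _ _
  linearIndependent := linearIndependent_empty_type

section

variable {V : ℕ → Type*} [∀ i, AddCommGroup (V i)] [∀ i, Module K (V i)]
  {ρ : ∀ i, Representation K G (V i)} {p q α : ℕ}

theorem IsIndecomposableSystem.exists_isNilpotentBlock (hρ : IsIndecomposableSystem ρ q)
    (hp : p.Prime) [CharP K p] {g : G} (hg : ∀ h : G, ∃ t : ℕ, g ^ t = h) (hα : g ^ p ^ α = 1)
    {i : ℕ} (hi : i ≤ q) : ∃ v, IsNilpotentBlock (ρ i g - 1) i v := by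
  have := hρ.finiteDimensional i hi
  have hf := hρ.finrank_eq i hi
  rcases Nat.eq_zero_or_pos i with rfl | h0
  · have := Module.finrank_zero_iff.1 hf
    exact ⟨0, isNilpotentBlock_of_subsingleton _⟩
  · have h := Representation.exists_isNilpotentBlock hp (ρ i) hg hα (hρ.indecomposable i h0 hi)
    rwa [hf] at h

/-- The numerical criterion for a Jordan partition to be standard. -/
theorem isStandardJordanPartition_iff (hρ : IsIndecomposableSystem ρ q) (hp : p.Prime)
    [CharP K p] {g : G} (hg : ∀ h : G, ∃ t : ℕ, g ^ t = h) (hα : g ^ p ^ α = 1) (hq : q = p ^ α)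
    {m n : ℕ} (hmn : m ≤ n) (hn : n ≤ q) :
    IsStandardJordanPartition ρ q m n ↔ StdNum p m n := by
  have := Fact.mk hp
  have hdet : StdNum p m n ↔
      ∀ c, 1 ≤ c → c ≤ m → ((chooseToeplitz (m - c) (n - c) c).det : K) ≠ 0 := by
    simp only [Ne, CharP.intCast_eq_zero_iff K p, not_dvd_det_chooseToeplitz_iff]
    constructor
    · intro h c hc hcm s hs
      exact (forall_boxGood_iff _ m n (two_le_pow_of_one_le hp.two_le hs) hmn).2 (h s hs) c hc hcm
    · intro h s hs
      exact (forall_boxGood_iff _ m n (two_le_pow_of_one_le hp.two_le hs) hmn).1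
        fun c hc hcm => h c hc hcm s hs
  choose! v hv using fun i (hi : i ≤ q) => hρ.exists_isNilpotentBlock hp hg hα hi
  have hFD := hρ.finiteDimensional
  have hfr := hρ.finrank_eq
  have := hFD m (hmn.trans hn)
  have := hFD n hn
  set T : Module.End K (V m ⊗[K] V n) := TensorProduct.map (ρ m g) (ρ n g) with hT
  have hmodel := isMonomialModel_tensorMonomial (v := v m) (w := v n)
    (hv m (hmn.trans hn)).pow_eq_zero (hv n hn).pow_eq_zero
  have hfin : Module.finrank K (V m ⊗[K] V n) = m * n := by
    rw [Module.finrank_tensorProduct, hfr m (hmn.trans hn), hfr n hn]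
  have hinj : Function.Injective (ρ m g) := by
    intro x y hxy
    have h1 := congrArg (ρ m g⁻¹) hxy
    simpa [← Module.End.mul_apply, ← map_mul] using h1
  let bn := basisOfLinearIndependentOfCardEqFinrank' _ (hv n hn).linearIndependent
    (by simp [hfr n hn])
  have hli := linearIndependent_tensorMonomial (B := ρ n g) (w := v n) (hv m (hmn.trans hn)) hinj bn
    (by simp [bn])
  let B := basisOfLinearIndependentOfCardEqFinrank' _ hli (by simp [hfin])
  have hB : ∀ x, B x = tensorMonomial (ρ m g) (v m) (ρ n g) (v n) x.1 x.2 := by simp [B]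
  rw [hdet]
  constructor
  · rintro ⟨l, ⟨-, hl, ⟨φ⟩⟩, hstd⟩ c - hcm
    -- The subtraction is not truncated: `i < m ≤ n` keeps every part positive.
    obtain rfl : l = fun i : Fin m => m + n - 1 - 2 * (i : ℕ) := by
      funext i
      have := hstd i
      omega
    let E : V m ⊗[K] V n ≃ₗ[K] ⨁ i : Fin m, V (m + n - 1 - 2 * (i : ℕ)) := φ.toLinearEquiv
    have hE : ∀ x, E (T x) = DirectSum.lmap
        (fun i : Fin m => ρ (m + n - 1 - 2 * (i : ℕ)) g) (E x) := fun x =>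
      LinearMap.congr_fun (φ.toIntertwiningMap.isIntertwining' g) x
    refine IsMonomialModel.det_ne_zero_of_strings hmodel hmn B hB
      (fun i => E.symm (DirectSum.lof K (Fin m) (fun i => V (m + n - 1 - 2 * (i : ℕ))) i
        (v (m + n - 1 - 2 * (i : ℕ))))) ?_ c hcm
    have hpow : ∀ (t : ℕ) x, E (((T - 1) ^ t) x) = ((DirectSum.lmap
        (fun i : Fin m => ρ (m + n - 1 - 2 * (i : ℕ)) g) - 1 : Module.End K _) ^ t) (E x) := by
      intro t x
      induction t with
      | zero => simp
      | succ t ih =>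
        rw [pow_succ', Module.End.mul_apply, pow_succ', Module.End.mul_apply, ← ih]
        simp only [LinearMap.sub_apply, map_sub, hE, Module.End.one_apply]
    refine LinearIndependent.of_comp E.toLinearMap ?_
    have h1 := linearIndependent_lof (fun i : Fin m => ρ (m + n - 1 - 2 * (i : ℕ)) g)
      (fun i => v (m + n - 1 - 2 * (i : ℕ))) (fun i => hv _ (hl i).2)
    convert! h1 using 2 with x
    simp only [Function.comp_apply, LinearEquiv.coe_coe]
    rw [hpow, LinearEquiv.apply_symm_apply]
  · intro hd
    obtain ⟨w, hw, hws⟩ := hmodel.exists_strings hmn B hB hd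
    have hTq : (T - 1) ^ q = 0 := by
      rw [hq]
      refine sub_one_pow_eq_zero hp _ _ ?_
      have : T = ((ρ m).tprod (ρ n)) g := rfl
      rw [this, ← map_pow, hα, map_one]
    -- A longer string would contradict `(T - 1) ^ q = 0`; without this bound nothing is known about
    -- the `V` of that index.
    have hlq : ∀ i : Fin m, m + n - 1 - 2 * (i : ℕ) ≤ q := by
      intro i
      by_contra hlt
      have := hws.ne_zero ⟨i, ⟨q, by omega⟩⟩
      simp only at this
      rw [← hT, hTq] at this
      simp at this
    have hFD' : ∀ i : Fin m, FiniteDimensional K (V (m + n - 1 - 2 * (i : ℕ))) :=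
      fun i => hFD _ (hlq i)
    obtain ⟨E, hE⟩ := exists_linearEquiv_lmap
      (fun i : Fin m => ρ (m + n - 1 - 2 * (i : ℕ)) g) (fun i => v (m + n - 1 - 2 * (i : ℕ)))
      (fun i => hv _ (hlq i)) (fun i => hfr _ (hlq i)) T w hw hws
      (by rw [hfin, IsMonomialModel.sum_standard_parts m n hmn])
    refine ⟨fun i => m + n - 1 - 2 * (i : ℕ), ⟨?_, fun i => ⟨by simp only; omega, hlq i⟩, ⟨?_⟩⟩, ?_⟩
    · intro i j hij
      have : (i : ℕ) ≤ j := hij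
      simp only
      omega
    · refine Representation.Equiv.mk E fun h => ?_
      obtain ⟨t, rfl⟩ := hg h
      rw [map_pow, map_pow]
      refine LinearMap.ext fun x => ?_
      simp only [LinearMap.comp_apply, LinearEquiv.coe_coe]
      induction t generalizing x with
      | zero => simp
      | succ t ih =>
        rw [pow_succ, pow_succ, Module.End.mul_apply, Module.End.mul_apply, ih]
        congr 1
        exact hE x
    · intro i
      simp only
      omega

end

end

/-! ### Assembly of the six cases. -/

theorem proposition1
    {p : ℕ} (hp : p.Prime)
    {K : Type*} [Field K] [CharP K p]
    {G : Type*} [Group G] [IsCyclic G] {q α : ℕ} (hq : q = p ^ α) (hG : Nat.card G = q)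
    {V : ℕ → Type*} [∀ i, AddCommGroup (V i)] [∀ i, Module K (V i)]
    (ρ : ∀ i, Representation K G (V i)) (hρ : IsIndecomposableSystem ρ q)
    {m n : ℕ} (hm : 0 < m) (hmn : m ≤ n) (hnq : n ≤ q)
    {k a b c d : ℕ}
    (hn : n = b * p ^ k + d) (hb : 0 < b) (hbp : b < p) (hd : d < p ^ k)
    (hmac : m = a * p ^ k + c) (hap : a < p) (hc : c < p ^ k) :
    -- Case 1
    (m + n > p ^ (k + 1) →
      (IsStandardJordanPartition ρ q m n ↔
        m + n - p ^ (k + 1) = 1 ∧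
          IsStandardJordanPartition ρ q (p ^ (k + 1) - n) (p ^ (k + 1) - m))) ∧
    -- Case 2
    (m + n ≤ p ^ (k + 1) → c + d > p ^ k →
      (IsStandardJordanPartition ρ q m n ↔
        c + d - p ^ k = 1 ∧
          IsStandardJordanPartition ρ q
            ((a + b + 1) * p ^ k - n) ((a + b + 1) * p ^ k - m))) ∧
    -- Case 3
    (m + n ≤ p ^ (k + 1) → 1 ≤ c + d → c + d ≤ p ^ k → a > 0 →
      (IsStandardJordanPartition ρ q m n ↔
        IsStandardJordanPartition ρ q (min c d) (max c d) ∧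
          |(c : ℤ) - (d : ℤ)| ≤ 1 ∧
          IsStandardJordanPartition ρ q ((a + b) * p ^ k - n) ((a + b) * p ^ k - m))) ∧
    -- Case 4
    (m + n ≤ p ^ (k + 1) → 1 ≤ c + d → c + d ≤ p ^ k → a = 0 → d > 0 →
      (IsStandardJordanPartition ρ q m n ↔
        IsStandardJordanPartition ρ q m (b * p ^ k - d))) ∧
    -- Case 5
    (m + n ≤ p ^ (k + 1) → 1 ≤ c + d → c + d ≤ p ^ k → a = 0 → d = 0 →
      (IsStandardJordanPartition ρ q m n ↔ m = 1)) ∧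
    -- Case 6
    (m + n ≤ p ^ (k + 1) → c = 0 → d = 0 →
      (IsStandardJordanPartition ρ q m n ↔ k = 0)) := by
  obtain ⟨g, hg⟩ : ∃ g : G, ∀ h : G, ∃ t : ℕ, g ^ t = h := by
    have hfin : Finite G := Nat.finite_of_card_ne_zero (by
      rw [hG, hq]; exact pow_ne_zero _ hp.ne_zero)
    obtain ⟨g, hg⟩ := IsCyclic.exists_generator (α := G)
    exact ⟨g, fun h => mem_powers_iff_mem_zpowers.2 (hg h)⟩
  have hα : g ^ p ^ α = 1 := by rw [← hq, ← hG, pow_card_eq_one']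
  -- This also applies to the reduced pairs: in each case their larger entry is at most `n`, hence
  -- at most `q`, and a first entry `0` is allowed.
  have key : ∀ {m n : ℕ}, m ≤ n → n ≤ q → (IsStandardJordanPartition ρ q m n ↔ StdNum p m n) :=
    fun h1 h2 => isStandardJordanPartition_iff hρ hp hg hα hq h1 h2
  have hp2 := hp.two_le
  have hQb : p ^ k ≤ b * p ^ k := Nat.le_mul_of_pos_left _ hb
  have hnlt : n < p ^ (k + 1) := by
    have := Nat.mul_le_mul_right (p ^ k) (Nat.succ_le_of_lt hbp)
    rw [Nat.succ_mul] at this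
    rw [pow_succ']
    omega
  rw [key hmn hnq]
  refine ⟨fun h => ?_, fun h h1 => ?_, fun h h1 h2 h3 => ?_, fun h h1 h2 h3 h4 => ?_,
    fun h h1 h2 h3 h4 => ?_, fun h h1 h2 => ?_⟩
  · rw [key (by omega) (by omega)]
    exact stdNum_iff_of_gt hp2 hm hmn hnlt h
  · have hR : (a + b + 1) * p ^ k = a * p ^ k + b * p ^ k + p ^ k := by ring
    rw [key (by omega) (by omega)]
    subst hn hmac
    exact stdNum_iff_of_residues_gt hp2 hc hd hmn hnlt h h1
  · have hR : (a + b) * p ^ k = a * p ^ k + b * p ^ k := by ring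
    rw [key (by omega) (by omega), key (by omega) (by omega)]
    subst hn hmac
    exact stdNum_iff_of_residues_le hp2 h3 hb hc hd hmn hnlt h h1 h2
  · subst h3
    rw [zero_mul, zero_add] at hmac
    rw [key (by omega) (by omega)]
    subst hn hmac
    exact stdNum_iff_neg_right hp2 hb hd hnlt h2
  · subst h3 h4
    rw [zero_mul, zero_add] at hmac
    rw [add_zero] at hn
    subst hn hmac
    exact stdNum_mul_pow_iff hp2 hc hm
  · subst h1 h2
    rw [add_zero] at hn hmac
    subst hn hmac
    have ha : 0 < a := Nat.pos_of_mul_pos_right hm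
    exact stdNum_mul_pow_mul_pow_iff hp2 ha (Nat.le_of_mul_le_mul_right hmn (by omega)) h
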